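/- **Model.** A tile type consists of four glues (north, south, east, west) and a color. A rectilinear tile assembly system (RTAS) is a finite set $M$ of tile types, no two of which have both the same south glue and the same west glue, together with an L-shaped seed exposing a north glue below each column and an east glue to the left of each row of a rectangle $\{1,\dots,w\}\times\{1,\dots,h\}$. A tile of a type in $M$ can attach at an empty position $(i,j)$ (column $i$, row $j$) of the rectangle iff its west glue equals the east glue already exposed at $(i-1,j)$ and its south glue equals the north glue already exposed at $(i,j-1)$. The RTAS uniquely assembles a pattern $P$ (a coloring of the rectangle) if exactly one terminal assembly can be built from the seed, and it fills the rectangle with the colors of $P$. Its size is $|M|$. **Colors.** There are 29: $B_0,B_1$ (Black, White), $C$ (Carry Blue), $E_0,E_1$ (el-Black, el-White), $R_0,R_1$ (RAB, RAW), $U_0,U_1$ (UAB, UAW), the Greens $G_{b,s}$ with $b,s\in\{0,1\}$ ($G_1=G_{0,1}$, $G_2=G_{0,0}$, $G_3=G_{1,1}$, $G_4=G_{1,0}$; $s=1$ means "subtraction ON"), $P_1,\dots,P_8$, and copies $B_0^k,B_1^k$ ($1\le k\le4$) of Black and White. The first nine are the colors usable in CIRCUIT. **Designed tile types of CIRCUIT.**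 There are 26, written (north, south, east, west; color), where $x,y,s$ range over $\{0,1\}$, $\oplus$ is addition mod 2, and $\beta(x,y)=(1-x)y$ is the borrow of $x-y$. The vertical glues are $\#$, $c_y$, $p_y$, $\sigma_{y,s}$ (9 distinct glues), the horizontal glues are $h_x$, $\tau_{x,s}$ (6 distinct glues): $(\#,\#,h_x,h_x;B_x)$; $(c_{\beta(x,y)},c_y,h_{x\oplus y},h_x;C)$; $(p_y,p_y,h_x,h_x;E_y)$; $(c_{\beta(x,ys)},\sigma_{y,s},\tau_{x\oplus ys,s},h_x;R_y)$; $(\sigma_{y,s},p_y,h_x,\tau_{x,s};U_y)$. **Sub-patterns.** A sub-pattern prescribes the colors of some cells (column, row), up to a common translation; it appears in $P$ if some translate of it lies inside the rectangle and agrees with $P$ on all prescribed cells. Let $\mathcal Y=\{B_0,P_1,\dots,P_8\}$. * LB1 ($7\times21$): columns 1, 3, 5, 7 are $B_0$, except for $B_1$ in row 20; columns 2, 4, 6 are $E_0$, $E_1$, $C$. * LB2–LB5, for $y,b\in\{0,1\}$: $(5,4)=U_y$, $(6,3)=B_y$, $(6,4)=B_b$. * LB6–LB41, for $y,b,s\in\{0,1\}$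 and $c\in\mathcal Y$: $R_y$ is immediately to the left of a $G_{b,s}$ that lies immediately above $c$. Moreover (in LB6 and LB15), each $G_{b,s}$ also appears immediately below $B_0$. * LB42 ($10\times5$): columns 2, 5, 7, 9 are $C$; columns 1, 3, 4, 6 are, from the bottom, $B_0,B_0,B_1,B_1,B_0$; columns 8, 10 are $B_1,B_1,B_0,B_1,B_0$. LB43–LB46: the same with $B_0^k,B_1^k$ in place of $B_0,B_1$, $k=1,\dots,4$. * LB47–LB82 ($y=0$, $n=6$) and LB83–LB118 ($y=1$, some $n\ge4$), for $b,s\in\{0,1\}$ and $c\in\mathcal Y$, with $x=b\oplus ys$. Row 2, from column 3 on: $B_x$, $R_y$, $n$ times $G_{b,s}$, $U_y$, some number $m\ge0$ of cells each colored $E_0$ or $E_1$, then $B_b$. Row 1: $c$ below each of the $n$ Greens, $E_y$ below $U_y$. Row 3: $(3,3)=B_d$, $(4,3)=C$, $(5,3)=B_{d\oplus\beta(x,ys)}$ for some $d\in\{0,1\}$. * GE1–GE6 ($y=0$) and GE7–GE12 ($y=1$): for $b,b',s\in\{0,1\}$, $(4,2)=G_{b,s}$, $(5,2)=U_y$, $(5,3)=R_y$,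 $(6,3)=G_{b',s}$; for each $s$ the three pairs $(b,b')\ne(1,1)$ if $y=0$, and some three of the four pairs $(b,b')$ if $y=1$. **Proposition.** Let PATTERN be a rectangular pattern in these 29 colors in which LB1–LB118 and GE1–GE12 appear, and let an RTAS with tile type set $M$ uniquely assemble PATTERN. Then either $|M|>46$, or $|M|=46$ and, up to an injective renaming of the vertical glues and an injective renaming of the horizontal glues, the tile types in $M$ having one of the nine colors usable in CIRCUIT are exactly the 26 designed ones. In particular, in any minimum tile type set for PATTERN these glues are the designed ones, or the minimum size exceeds 46. -/

import Mathlib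

/-!
Patterned self-assembly with rectilinear tile assembly systems, the tile types of a
subtraction circuit, and the auxiliary sub-patterns that force their glues.
Bits are Booleans: `false` is `0` ("Black"), `true` is `1` ("White").
Indices of positions are natural numbers starting at `1`; the seed occupies row `0` and column `0`.
-/

/-- The 29 colors. -/
inductive Color : Type
  /-- `bit false` is Black, `bit true` is White. -/
  | bit (b : Bool)
  /-- Carry Blue. -/
  | carry
  /-- `el false` is el-Black, `el true` is el-White. -/
  | el (b : Bool)
  /-- Right-Arrow Black and Right-Arrow White (RAB, RAW). -/
  | rightArrow (b : Bool)
  /-- Up-Arrow Black and Up-Arrow White (UAB, UAW). -/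
  | upArrow (b : Bool)
  /-- The four Green colors: G1 is `green false true`, G2 is `green false false`,
  G3 is `green true true`, G4 is `green true false`; the first argument is a bit, the second
  tells whether the subtraction signal is ON. -/
  | green (b on : Bool)
  /-- The Purple colors P1, ..., P8. -/
  | purple (i : Fin 8)
  /-- The copies Black1, ..., Black4 (`b = false`) and White1, ..., White4 (`b = true`). -/
  | bitCopy (i : Fin 4) (b : Bool)

/-- A tile type: four glues and a color. `V` and `H` are the types of the vertical glues
(north and south) and of the horizontal glues (east and west). -/
@[ext] structure TileType (V H : Type*) where
  north : V
  south : V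
  east : H
  west : H
  color : Color

/-- Renaming of glues. -/
def TileType.rename {V H V' H' : Type*} (ν : V → V') (η : H → H') (t : TileType V H) :
    TileType V' H' where
  north := ν t.north
  south := ν t.south
  east := η t.east
  west := η t.west
  color := t.color

/-- A rectangular color pattern; only the values of `color` on `{1..width} × {1..height}` matter,
the first argument is the column, the second one the row. -/
structure Pattern where
  width : ℕ
  height : ℕ
  color : ℕ → ℕ → Color

/-- `(i, j)` is a position of the rectangle of the pattern. -/
def Pattern.InRange (P : Pattern) (i j : ℕ) : Prop :=
  1 ≤ i ∧ i ≤ P.width ∧ 1 ≤ j ∧ j ≤ P.height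

/-! ### Rectilinear tile assembly systems -/

/-- A rectilinear tile assembly system: a finite tile type set in which no two tile types clash
(have the same south glue and the same west glue), and an L-shaped seed, given by the north
glues exposed by row `0` and the east glues exposed by column `0`. -/
structure RTAS (Glue : Type*) where
  tiles : Finset (TileType Glue Glue)
  seedNorth : ℕ → Glue
  seedEast : ℕ → Glue
  unique : ∀ t ∈ tiles, ∀ u ∈ tiles, t.south = u.south → t.west = u.west → t = u

namespace RTAS

variable {Glue : Type*}

/-- A (partial) assembly: the tile placed at each position, if any. -/
abbrev Assembly (Glue : Type*) := ℕ → ℕ → Option (TileType Glue Glue)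

/-- The glue that position `(i, j)` is offered from the west (column `1` lies next to the seed). -/
def westInput (S : RTAS Glue) (A : Assembly Glue) (i j : ℕ) : Option Glue :=
  if i = 1 then some (S.seedEast j) else (A (i - 1) j).map TileType.east

/-- The glue that position `(i, j)` is offered from the south (row `1` lies next to the seed). -/
def southInput (S : RTAS Glue) (A : Assembly Glue) (i j : ℕ) : Option Glue :=
  if j = 1 then some (S.seedNorth i) else (A i (j - 1)).map TileType.north

/-- A tile of type `t` can attach to `A` at the empty position `(i, j)` of the rectangle of `P`. -/
def CanAttach (S : RTAS Glue) (P : Pattern) (A : Assembly Glue) (i j : ℕ)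
    (t : TileType Glue Glue) : Prop :=
  P.InRange i j ∧ A i j = none ∧ t ∈ S.tiles ∧
    S.westInput A i j = some t.west ∧ S.southInput A i j = some t.south

/-- Placing a tile. -/
def place (A : Assembly Glue) (i j : ℕ) (t : TileType Glue Glue) : Assembly Glue :=
  fun i' j' => if i' = i ∧ j' = j then some t else A i' j'

/-- The assemblies that can be built from the seed by successive attachments, where the seed
spans the rectangle of `P`. -/
inductive Producible (S : RTAS Glue) (P : Pattern) : Assembly Glue → Prop
  | seed : Producible S P (fun _ _ => none)
  | attach {A : Assembly Glue} {i j : ℕ} {t : TileType Glue Glue} :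
      Producible S P A → S.CanAttach P A i j t → Producible S P (place A i j t)

/-- No tile can attach any more. -/
def Terminal (S : RTAS Glue) (P : Pattern) (A : Assembly Glue) : Prop :=
  ∀ i j t, ¬ S.CanAttach P A i j t

/-- `S` uniquely self-assembles `P`: exactly one terminal assembly can be built from the seed,
it fills the rectangle, and its colors are those of `P`. -/
def UniquelyAssembles (S : RTAS Glue) (P : Pattern) : Prop :=
  ∃ A, (S.Producible P A ∧ S.Terminal P A) ∧
    (∀ B, S.Producible P B → S.Terminal P B → B = A) ∧
    ∀ i j, P.InRange i j → ∃ t, A i j = some t ∧ t.color = P.color i j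

end RTAS

/-! ### The designed tile types of the circuit -/

/-- Vertical glues of the circuit: `#`; `0vc`, `1vc`; `0vp`, `1vp`; and `0*`, `0x`, `1*`, `1x`
(a bit together with the subtraction signal, `true` being ON, written `*`). -/
inductive VGlue : Type
  | hash
  | carry (b : Bool)
  | pass (b : Bool)
  | signal (b on : Bool)

/-- Horizontal glues of the circuit: `0h`, `1h`; and `0*`, `0x`, `1*`, `1x`. -/
inductive HGlue : Type
  | bit (b : Bool)
  | signal (b on : Bool)

/-- The borrow of the one-bit subtraction `x - y`; its difference bit is `xor x y`. -/
def borrow (x y : Bool) : Bool := !x && y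

/-- The 26 designed tile types that can be used in the circuit. -/
inductive Designed : TileType VGlue HGlue → Prop
  /-- Black (`x = 0`) and White (`x = 1`). -/
  | bit (x : Bool) : Designed
      { north := .hash, south := .hash, east := .bit x, west := .bit x, color := .bit x }
  /-- Carry Blue, half-subtractors: west minus south to the east, borrow to the north. -/
  | carry (x y : Bool) : Designed
      { north := .carry (borrow x y), south := .carry y, east := .bit (xor x y), west := .bit x,
        color := .carry }
  /-- el-Black (`y = 0`) and el-White (`y = 1`): vertical and horizontal bits pass through. -/
  | el (y x : Bool) : Designed
      { north := .pass y, south := .pass y, east := .bit x, west := .bit x, color := .el y }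
  /-- RAB (`y = 0`) and RAW (`y = 1`): a half-subtractor if the signal is ON; if it is OFF, `0` is
  subtracted; the signal is handed on to the east. -/
  | rightArrow (y x on : Bool) : Designed
      { north := .carry (borrow x (y && on)), south := .signal y on,
        east := .signal (xor x (y && on)) on, west := .bit x, color := .rightArrow y }
  /-- UAB (`y = 0`) and UAW (`y = 1`): the signal is turned to the north. -/
  | upArrow (y x on : Bool) : Designed
      { north := .signal y on, south := .pass y, east := .bit x, west := .signal x on,
        color := .upArrow y }

/-- The nine colors used in the circuit: Black, White, Carry Blue, el-Black, el-White, RAB, RAW,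
UAB and UAW. -/
def Color.InCircuit : Color → Prop
  | .bit _ | .carry | .el _ | .rightArrow _ | .upArrow _ => True
  | .green _ _ | .purple _ | .bitCopy _ _ => False

/-- Up to an (injective) renaming of the vertical and of the horizontal glues, the tile types of
`M` with colors of the circuit are exactly the designed ones. -/
def HasDesignedCircuitTiles {Glue : Type*} (M : Finset (TileType Glue Glue)) : Prop :=
  ∃ (ν : VGlue → Glue) (η : HGlue → Glue), Function.Injective ν ∧ Function.Injective η ∧
    ∀ t : TileType Glue Glue,
      (t ∈ M ∧ t.color.InCircuit) ↔ ∃ d, Designed d ∧ t = d.rename ν η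

/-! ### Sub-patterns -/

/-- A sub-pattern, in its own coordinates (column, row); `none` means that the color of that cell
is not prescribed. -/
abbrev SubPattern := ℕ → ℕ → Option Color

/-- `F` appears in `P`, at some place inside the rectangle of `P`. -/
def Pattern.Contains (P : Pattern) (F : SubPattern) : Prop :=
  ∃ a b : ℕ, ∀ i j c, F i j = some c → P.InRange (a + i) (b + j) ∧ P.color (a + i) (b + j) = c

/-- LB1, 7 columns and 21 rows: columns 1, 3, 5, 7 are Black except for White in row 20, and
columns 2, 4, 6 are el-Black, el-White and Carry Blue. -/
def LB1 : SubPattern := fun i j =>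
  if 1 ≤ i ∧ i ≤ 7 ∧ 1 ≤ j ∧ j ≤ 21 then
    some (if i = 2 then .el false else if i = 4 then .el true else if i = 6 then .carry
      else .bit (decide (j = 20)))
  else none

/-- LB2, LB3 (`y = 0`) and LB4, LB5 (`y = 1`): the upper right corner of the subtraction of
`0`, respectively of `2 ^ (number of rows)`. -/
def LBTop (y b : Bool) : SubPattern := fun i j =>
  if i = 5 ∧ j = 4 then some (.upArrow y)
  else if i = 6 ∧ j = 3 then some (.bit y)
  else if i = 6 ∧ j = 4 then some (.bit b)
  else none

/-- LB6 to LB23 (`y = 0`) and LB24 to LB41 (`y = 1`): to the right of a Right-Arrow there is a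
Green color, which lies above the variable color `c`. -/
def LBGreen (y b on : Bool) (c : Color) : SubPattern := fun i j =>
  if i = 1 ∧ j = 2 then some (.rightArrow y)
  else if i = 2 ∧ j = 2 then some (.green b on)
  else if i = 2 ∧ j = 1 then some c
  else none

/-- Further cells of LB6 and LB15: each Green color appears directly below Black. -/
def LBGreenBlack (b on : Bool) : SubPattern := fun i j =>
  if i = 1 ∧ j = 1 then some (.green b on)
  else if i = 1 ∧ j = 2 then some (.bit false)
  else none

/-- LB42, 10 columns and 5 rows, and its copies LB43 to LB46, with `β false` and `β true` in the
roles of Black and White: columns 2, 5, 7, 9 are Carry Blue, columns 1, 3, 4, 6 are `0, 0, 1, 1, 0`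
and columns 8, 10 are `1, 1, 0, 1, 0` (from the bottom). -/
def LB42 (β : Bool → Color) : SubPattern := fun i j =>
  if 1 ≤ i ∧ i ≤ 10 ∧ 1 ≤ j ∧ j ≤ 5 then
    some (if i = 2 ∨ i = 5 ∨ i = 7 ∨ i = 9 then .carry
      else if i ≤ 6 then β (decide (j = 3 ∨ j = 4))
      else β (decide (j = 1 ∨ j = 2 ∨ j = 4)))
  else none

/-- LB47 to LB82 (`y = 0`, `n = 6`) and LB83 to LB118 (`y = 1`, `n ≥ 4`).
In row 2: a bit, a Right-Arrow, `n` times a Green color, an Up-Arrow, then `m` el-tiles (an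
ellipsis, with colors given by `e`), then a bit. In row 1: the variable color `c` below the
Greens and `el y` below the Up-Arrow. In row 3: Carry Blue above the Right-Arrow, between two bits.
With `y' = y && on` being the bit subtracted, the bit on the left in row 2 is the one from which
subtracting `y'` gives `b`, and the bits in row 3 differ exactly if this subtraction borrows. -/
def LBArrow (y : Bool) (n : ℕ) (b on : Bool) (c : Color) (d : Bool) (m : ℕ) (e : ℕ → Bool) :
    SubPattern := fun i j =>
  if j = 1 then
    if 5 ≤ i ∧ i ≤ 4 + n then some c
    else if i = 5 + n then some (.el y)
    else none
  else if j = 2 then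
    if i = 3 then some (.bit (xor b (y && on)))
    else if i = 4 then some (.rightArrow y)
    else if 5 ≤ i ∧ i ≤ 4 + n then some (.green b on)
    else if i = 5 + n then some (.upArrow y)
    else if 6 + n ≤ i ∧ i < 6 + n + m then some (.el (e i))
    else if i = 6 + n + m then some (.bit b)
    else none
  else if j = 3 then
    if i = 3 then some (.bit d)
    else if i = 4 then some .carry
    else if i = 5 then some (.bit (xor d (borrow (xor b (y && on)) (y && on))))
    else none
  else none

/-- GE1 to GE6 (`y = 0`) and GE7 to GE12 (`y = 1`): an Up-Arrow, to the right of the Green color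
`green b on`, lies below a Right-Arrow, to the left of the Green color `green b' on`. -/
def GEArrow (y b b' on : Bool) : SubPattern := fun i j =>
  if i = 4 ∧ j = 2 then some (.green b on)
  else if i = 5 ∧ j = 2 then some (.upArrow y)
  else if i = 5 ∧ j = 3 then some (.rightArrow y)
  else if i = 6 ∧ j = 3 then some (.green b' on)
  else none

/-- The nine values of the variable color: Black and the Purple colors. -/
def Color.IsVariable (c : Color) : Prop := c = .bit false ∨ ∃ i, c = .purple i

/-- LB1 to LB118 appear in `P`. -/
structure ContainsLB (P : Pattern) : Prop where
  lb1 : P.Contains LB1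
  lb2_5 : ∀ y b, P.Contains (LBTop y b)
  lb6_41 : ∀ y b on c, c.IsVariable → P.Contains (LBGreen y b on c)
  lb6_15 : ∀ b on, P.Contains (LBGreenBlack b on)
  lb42 : P.Contains (LB42 Color.bit)
  lb43_46 : ∀ i, P.Contains (LB42 (Color.bitCopy i))
  lb47_82 : ∀ b on c, c.IsVariable → ∃ d m e, P.Contains (LBArrow false 6 b on c d m e)
  lb83_118 : ∀ b on c, c.IsVariable →
    ∃ n d m e, 4 ≤ n ∧ P.Contains (LBArrow true n b on c d m e)

/-- GE1 to GE12 appear in `P`. For each signal, GE1, GE2, GE3 (respectively GE4, GE5, GE6) show the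
pairs `(b, b') = (0, 0), (0, 1), (1, 0)` for UAB and RAB; their analogues for UAW and RAW show
three of the four pairs as well, and it does not matter which pair `(u, u')` is left out. -/
structure ContainsGE (P : Pattern) : Prop where
  ge1_6 : ∀ on b b', (b, b') ≠ (true, true) → P.Contains (GEArrow false b b' on)
  ge7_12 : ∀ on, ∃ u u', ∀ b b', (b, b') ≠ (u, u') → P.Contains (GEArrow true b b' on)

/-! ### Tilings of sub-patterns -/

/-! The argument uses the assembly system only through two facts: its tile set is deterministic
(south and west glue determine the tile type), and every sub-pattern of the pattern can be tiled
with matching glues. Everything else is counting tile types color by color.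

The bound 46 is 26 for the circuit colors (2 bits, 4 Carry Blue, 4 el, 8 Right-Arrows, 8 Up-Arrows)
plus one type for each of the 20 other colors. The lower bounds rest on two mechanisms. If one color
appears next to the same pair of tile types, it is determined; so colors that vary need varied
neighbors (`four_le_card_mul_card_rightArrow`, `two_le_card_upArrow_or_bit`, `exists_carry`). And
along a line with constant input from the side, each tile determines the next; so a run longer than
the number of its tile types becomes periodic and cannot count its length (`card_black_of_LB1`,
`card_le_card_upArrow`).

These bounds are alternatives: a color may avoid its quota if another one is inflated. The eight
Purples and the four copies of the bits make inflation unaffordable, and `hasDesignedCounts` shows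
that with at most 46 types every circuit color and every Green has exactly its quota. Then the
families found in the sub-patterns exhaust their colors, and gluing conditions along adjacent cells
identify the glues: bits first, then Carry Blue, el and the Greens, and finally the arrows. The GE
patterns are needed only at the end, to identify the vertical glue between an Up-Arrow and a
Right-Arrow. Distinctness of all glues follows from determinism. -/

/-- No two tile types have the same south and the same west glue. -/
def Deterministic {G : Type*} (M : Finset (TileType G G)) : Prop :=
  ∀ t ∈ M, ∀ u ∈ M, t.south = u.south → t.west = u.west → t = u

/-- `T` covers the prescribed cells of `F` by tiles of `M`, with the right colors and with
matching glues. -/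
structure IsTiling {G : Type*} (M : Finset (TileType G G)) (F : SubPattern)
    (T : ℕ → ℕ → TileType G G) : Prop where
  mem : ∀ {i j c}, F i j = some c → T i j ∈ M
  color : ∀ {i j c}, F i j = some c → (T i j).color = c
  east : ∀ {i j c c'}, F i j = some c → F (i + 1) j = some c' → (T i j).east = (T (i + 1) j).west
  north : ∀ {i j c c'}, F i j = some c → F i (j + 1) = some c' →
    (T i j).north = (T i (j + 1)).south

/-- Every sub-pattern of `P` can be tiled by `M`. -/
def TilesSubPatterns {G : Type*} (M : Finset (TileType G G)) (P : Pattern) : Prop :=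
  ∀ F, P.Contains F → ∃ T, IsTiling M F T

/-- Attachments only fill empty positions, so the glues offered to a placed tile never change
afterwards. -/
theorem RTAS.Producible.glues {G : Type*} {S : RTAS G} {P : Pattern} {A : RTAS.Assembly G}
    (hA : S.Producible P A) : ∀ i j t, A i j = some t →
      t ∈ S.tiles ∧ S.westInput A i j = some t.west ∧ S.southInput A i j = some t.south := by
  induction hA with
  | seed => intro i j t h; simp at h
  | @attach A i j t _ hatt ih =>
    obtain ⟨hR, hnone, hmem, hw, hs⟩ := hatt
    have keep : ∀ i' j' u, A i' j' = some u → RTAS.place A i j t i' j' = some u := by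
      intro i' j' u hu
      have : ¬ (i' = i ∧ j' = j) := by
        rintro ⟨rfl, rfl⟩
        simp [hnone] at hu
      simp [RTAS.place, this, hu]
    have west : ∀ i' j' g, S.westInput A i' j' = some g →
        S.westInput (RTAS.place A i j t) i' j' = some g := by
      intro i' j' g hg
      unfold RTAS.westInput at hg ⊢
      split_ifs at hg ⊢ with h1
      · exact hg
      · obtain ⟨u, hu, rfl⟩ := Option.map_eq_some_iff.1 hg
        rw [keep _ _ _ hu, Option.map_some]
    have south : ∀ i' j' g, S.southInput A i' j' = some g →
        S.southInput (RTAS.place A i j t) i' j' = some g := by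
      intro i' j' g hg
      unfold RTAS.southInput at hg ⊢
      split_ifs at hg ⊢ with h1
      · exact hg
      · obtain ⟨u, hu, rfl⟩ := Option.map_eq_some_iff.1 hg
        rw [keep _ _ _ hu, Option.map_some]
    intro i' j' u hu
    by_cases h : i' = i ∧ j' = j
    · obtain ⟨rfl, rfl⟩ := h
      obtain rfl : t = u := by simpa [RTAS.place] using hu
      exact ⟨hmem, west _ _ _ hw, south _ _ _ hs⟩
    · have hu' : A i' j' = some u := by simpa [RTAS.place, h] using hu
      obtain ⟨h1, h2, h3⟩ := ih i' j' u hu'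
      exact ⟨h1, west _ _ _ h2, south _ _ _ h3⟩

theorem RTAS.UniquelyAssembles.tilesSubPatterns {G : Type*} {S : RTAS G} {P : Pattern}
    (hS : S.UniquelyAssembles P) : TilesSubPatterns S.tiles P := by
  obtain ⟨A, ⟨hA, -⟩, -, hfill⟩ := hS
  have hg := hA.glues
  rintro F ⟨a, b, hF⟩
  -- Cells that `F` leaves free may be empty in `A`; they receive a filler tile made of an arbitrary
  -- glue, which no condition inspects.
  let g := S.seedNorth 0
  let T : ℕ → ℕ → TileType G G := fun i j => (A (a + i) (b + j)).getD ⟨g, g, g, g, .carry⟩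
  have hT : ∀ {i j c}, F i j = some c → A (a + i) (b + j) = some (T i j) ∧ (T i j).color = c := by
    intro i j c h
    obtain ⟨hr, hc⟩ := hF i j c h
    obtain ⟨t, ht, htc⟩ := hfill _ _ hr
    have : T i j = t := by simp [T, ht]
    rw [this]
    exact ⟨ht, htc.trans hc⟩
  refine ⟨T, fun h => (hg _ _ _ (hT h).1).1, fun h => (hT h).2, ?_, ?_⟩
  · intro i j c c' h h'
    have h1 := (hg _ _ _ (hT h').1).2.1
    -- The left neighbor lies in the rectangle, so the cell itself is not in column 1 and its west
    -- input comes from a tile, not from the seed.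
    have hr := (hF _ _ _ h).1.1
    have e : a + (i + 1) - 1 = a + i := by omega
    rw [RTAS.westInput, if_neg (by omega), e, (hT h).1] at h1
    simpa using h1
  · intro i j c c' h h'
    have h1 := (hg _ _ _ (hT h').1).2.2
    have hr := (hF _ _ _ h).1.2.2.1
    have e : b + (j + 1) - 1 = b + j := by omega
    rw [RTAS.southInput, if_neg (by omega), e, (hT h).1] at h1
    simpa using h1

/-! ### Counting tile types by color -/

open Classical in
/-- The tile types of color `c`. -/
noncomputable def colorClass {G : Type*} (M : Finset (TileType G G)) (c : Color) :
    Finset (TileType G G) :=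
  M.filter fun t => t.color = c

theorem mem_colorClass {G : Type*} {M : Finset (TileType G G)} {c : Color} {t : TileType G G} :
    t ∈ colorClass M c ↔ t ∈ M ∧ t.color = c := by
  classical
  simp [colorClass]

theorem IsTiling.mem_colorClass {G : Type*} {M : Finset (TileType G G)} {F : SubPattern}
    {T : ℕ → ℕ → TileType G G} (h : IsTiling M F T) {i j : ℕ} {c : Color} (hF : F i j = some c) :
    T i j ∈ colorClass M c :=
  _root_.mem_colorClass.2 ⟨h.mem hF, h.color hF⟩

theorem Deterministic.eq_of_mem_colorClass {G : Type*} {M : Finset (TileType G G)}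
    (hM : Deterministic M) {c c' : Color} {t u : TileType G G} (ht : t ∈ colorClass M c)
    (hu : u ∈ colorClass M c') (hs : t.south = u.south) (hw : t.west = u.west) : c = c' := by
  rw [mem_colorClass] at ht hu
  rw [← ht.2, ← hu.2, hM t ht.1 u hu.1 hs hw]

theorem eq_of_card_le_one {α : Type*} {C : Finset α} (hC : C.card ≤ 1) {t u : α} (ht : t ∈ C)
    (hu : u ∈ C) : t = u :=
  Finset.card_le_one.1 hC t ht u hu

/-- The colors, arranged as a disjoint union. -/
def colorEquiv : Color ≃ (Bool ⊕ Unit ⊕ Bool ⊕ Bool ⊕ Bool) ⊕ (Bool × Bool) ⊕ Fin 8 ⊕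
    (Fin 4 × Bool) where
  toFun
    | .bit b => .inl (.inl b)
    | .carry => .inl (.inr (.inl ()))
    | .el b => .inl (.inr (.inr (.inl b)))
    | .rightArrow b => .inl (.inr (.inr (.inr (.inl b))))
    | .upArrow b => .inl (.inr (.inr (.inr (.inr b))))
    | .green b on => .inr (.inl (b, on))
    | .purple i => .inr (.inr (.inl i))
    | .bitCopy i b => .inr (.inr (.inr (i, b)))
  invFun
    | .inl (.inl b) => .bit b
    | .inl (.inr (.inl ())) => .carry
    | .inl (.inr (.inr (.inl b))) => .el b
    | .inl (.inr (.inr (.inr (.inl b)))) => .rightArrow b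
    | .inl (.inr (.inr (.inr (.inr b)))) => .upArrow b
    | .inr (.inl (b, on)) => .green b on
    | .inr (.inr (.inl i)) => .purple i
    | .inr (.inr (.inr (i, b))) => .bitCopy i b
  left_inv c := by cases c <;> rfl
  right_inv x := by rcases x with (_ | _ | _ | _ | _) | _ | _ | _ <;> rfl

theorem card_eq_sum_colorClass {G : Type*} (M : Finset (TileType G G)) :
    M.card = ∑ b, (colorClass M (.bit b)).card + (colorClass M .carry).card +
      ∑ b, (colorClass M (.el b)).card + ∑ b, (colorClass M (.rightArrow b)).card +
      ∑ b, (colorClass M (.upArrow b)).card + ∑ b, ∑ on, (colorClass M (.green b on)).card +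
      ∑ i, (colorClass M (.purple i)).card + ∑ i, ∑ b, (colorClass M (.bitCopy i b)).card := by
  classical
  let _ : Fintype Color := Fintype.ofEquiv _ colorEquiv.symm
  have h1 : M.card = ∑ c : Color, (colorClass M c).card := by
    rw [Finset.card_eq_sum_card_fiberwise (f := TileType.color) (t := Finset.univ)
      (fun _ _ => Finset.mem_coe.2 (Finset.mem_univ _))]
    rfl
  have h2 : ∑ c : Color, (colorClass M c).card =
      ∑ x, (colorClass M (colorEquiv.symm x)).card :=
    (Equiv.sum_comp colorEquiv.symm fun c => (colorClass M c).card).symm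
  rw [h1, h2]
  simp only [Fintype.sum_sum_type, Fintype.sum_prod_type, colorEquiv, Equiv.coe_fn_symm_mk,
    Finset.univ_unique, Finset.sum_singleton]
  ring

/-! ### Combinatorial lemmas -/

/-- A sequence in a small set, each term of which determines the next one, repeats its last
term. -/
theorem exists_eq_last {α : Type*} (s : ℕ → α) (C : Finset α) (n : ℕ) (hs : ∀ i < n, s i ∈ C)
    (hC : C.card < n)
    (hstep : ∀ i j, i + 1 < n → j + 1 < n → s i = s j → s (i + 1) = s (j + 1)) :
    ∃ i, i + 1 < n ∧ s i = s (n - 1) := by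
  obtain ⟨x, hx, y, hy, hxy, he⟩ := Finset.exists_ne_map_eq_of_card_lt_of_maps_to
    (s := Finset.range n) (t := C) (f := s) (by simpa using hC)
    (fun i hi => hs i (by simpa using hi))
  simp only [Finset.mem_range] at hx hy
  -- Pigeonhole gives one repetition; both of its indices are shifted forward together until the
  -- larger one is `n - 1`.
  have key : ∀ x y, x < y → s x = s y → ∀ m, y + m < n → s (x + m) = s (y + m) := by
    intro x y hlt he m
    induction m with
    | zero => intro _; simpa using he
    | succ m ih =>
      intro hm
      exact hstep (x + m) (y + m) (by omega) (by omega) (ih (by omega))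
  rcases lt_or_gt_of_ne hxy with h | h
  · refine ⟨x + (n - 1 - y), by omega, ?_⟩
    rw [key x y h he _ (by omega)]
    congr 1
    omega
  · refine ⟨y + (n - 1 - x), by omega, ?_⟩
    rw [key y x h he.symm _ (by omega)]
    congr 1
    omega

/-- This is how a tight count is exploited: once a family as large as the quota has been found in a
color class, the class contains nothing else. -/
theorem exists_eq_of_card_le {α ι : Type*} [Fintype ι] {C : Finset α} {f : ι → α}
    (hf : ∀ i, f i ∈ C) (hinj : Function.Injective f) (hC : C.card ≤ Fintype.card ι) {t : α}
    (ht : t ∈ C) : ∃ i, t = f i := by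
  classical
  have h : Finset.univ.image f = C := by
    apply Finset.eq_of_subset_of_card_le
    · intro x hx
      obtain ⟨i, -, rfl⟩ := Finset.mem_image.1 hx
      exact hf i
    · rwa [Finset.card_image_of_injective _ hinj, Finset.card_univ]
  rw [← h] at ht
  obtain ⟨i, -, rfl⟩ := Finset.mem_image.1 ht
  exact ⟨i, rfl⟩

theorem card_index_le {α ι : Type*} [Fintype ι] {C : Finset α} {f : ι → α}
    (hf : ∀ i, f i ∈ C) (hinj : Function.Injective f) : Fintype.card ι ≤ C.card := by
  classical
  rw [← Finset.card_univ]
  exact Finset.card_le_card_of_injOn f (fun i _ => hf i) hinj.injOn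

/-! ### Lower bounds on the numbers of tile types -/

section

variable {G : Type*} {M : Finset (TileType G G)} {P : Pattern}

theorem LB1_even {i j : ℕ} (hi : i = 2 ∨ i = 4 ∨ i = 6) (h1 : 1 ≤ j) (h2 : j ≤ 21) :
    LB1 i j = some (if i = 2 then .el false else if i = 4 then .el true else .carry) := by
  rcases hi with rfl | rfl | rfl <;> simp [LB1, h1, h2]

theorem LB1_odd {i j : ℕ} (hi : i = 1 ∨ i = 3 ∨ i = 5 ∨ i = 7) (h1 : 1 ≤ j) (h2 : j ≤ 21) :
    LB1 i j = some (.bit (decide (j = 20))) := by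
  rcases hi with rfl | rfl | rfl | rfl <;> simp [LB1, h1, h2]

/-- If the tile type in a column of LB1 is unique, then the column on its right has many. -/
theorem card_black_of_LB1 (hM : Deterministic M) {T : ℕ → ℕ → TileType G G}
    (hT : IsTiling M LB1 T) {i : ℕ} (hi : i = 2 ∨ i = 4 ∨ i = 6)
    (h1 : (colorClass M (if i = 2 then .el false else if i = 4 then .el true else .carry)).card ≤ 1) :
    19 ≤ (colorClass M (.bit false)).card := by
  by_contra! hlt
  have hodd : i + 1 = 1 ∨ i + 1 = 3 ∨ i + 1 = 5 ∨ i + 1 = 7 := by omega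
  -- A unique type on the left feeds the same west glue into every row, so going up this column each
  -- tile determines the next.
  have hw : ∀ j, 1 ≤ j → j ≤ 21 → (T (i + 1) j).west = (T i 1).east := by
    intro j hj1 hj2
    rw [← hT.east (LB1_even hi hj1 hj2) (LB1_odd hodd hj1 hj2),
      eq_of_card_le_one h1 (hT.mem_colorClass (LB1_even hi hj1 hj2))
        (hT.mem_colorClass (LB1_even hi le_rfl (by norm_num)))]
  have hstep : ∀ k l, k < 20 → l < 20 → T (i + 1) (k + 1) = T (i + 1) (l + 1) →
      T (i + 1) (k + 1 + 1) = T (i + 1) (l + 1 + 1) := by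
    intro k l hk hl h
    apply hM _ (hT.mem (LB1_odd hodd (by omega) (by omega))) _
      (hT.mem (LB1_odd hodd (by omega) (by omega)))
    · rw [← hT.north (LB1_odd hodd (by omega) (by omega)) (LB1_odd hodd (by omega) (by omega)), h,
        hT.north (LB1_odd hodd (by omega) (by omega)) (LB1_odd hodd (by omega) (by omega))]
    · rw [hw _ (by omega) (by omega), hw _ (by omega) (by omega)]
  -- Index 18 is row 19, the last Black below the White of row 20. If its tile type occurs earlier,
  -- its successor there is Black, contradicting White.
  obtain ⟨k, hk, he⟩ := exists_eq_last (fun k => T (i + 1) (k + 1)) _ 19 (fun k hk => by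
      have := hT.mem_colorClass (LB1_odd hodd (j := k + 1) (by omega) (by omega))
      rwa [decide_eq_false (by omega)] at this) hlt
    (fun k l hk hl h => hstep k l (by omega) (by omega) h)
  have h2 := congrArg TileType.color (hstep k 18 (by omega) (by omega) he)
  rw [hT.color (LB1_odd hodd (by omega) (by omega)),
    hT.color (LB1_odd hodd (by omega) (by omega)), decide_eq_false (by omega)] at h2
  simp at h2

/-- Greens of all kinds appear above `c`, on the right of `rightArrow y`. -/
theorem four_le_card_mul_card_rightArrow (hM : Deterministic M) (hP : TilesSubPatterns M P)
    (hLB : ContainsLB P) (y : Bool) {c : Color} (hc : c.IsVariable) :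
    4 ≤ (colorClass M c).card * (colorClass M (.rightArrow y)).card := by
  have h : ∀ p : Bool × Bool, ∃ q : TileType G G × TileType G G, ∃ g,
      q.1 ∈ colorClass M c ∧ q.2 ∈ colorClass M (.rightArrow y) ∧
      g ∈ colorClass M (.green p.1 p.2) ∧ q.1.north = g.south ∧ q.2.east = g.west := by
    rintro ⟨b, on⟩
    obtain ⟨T, hT⟩ := hP _ (hLB.lb6_41 y b on c hc)
    exact ⟨(T 2 1, T 1 2), T 2 2, hT.mem_colorClass (by simp [LBGreen]),
      hT.mem_colorClass (by simp [LBGreen]), hT.mem_colorClass (by simp [LBGreen]),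
      hT.north (c := c) (c' := .green b on) (by simp [LBGreen]) (by simp [LBGreen]),
      hT.east (c := .rightArrow y) (c' := .green b on) (by simp [LBGreen]) (by simp [LBGreen])⟩
  choose q g h1 h2 h3 h4 h5 using h
  rw [← Finset.card_product]
  -- The pair supplies the south and west glues of the Green, hence determines which of the four
  -- Greens it is.
  refine card_index_le (f := q) (fun p => Finset.mem_product.2 ⟨h1 p, h2 p⟩) ?_
  intro p p' hpp
  have := hM.eq_of_mem_colorClass (h3 p) (h3 p') (by rw [← h4, ← h4, hpp])
    (by rw [← h5, ← h5, hpp])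
  simp only [Color.green.injEq] at this
  exact Prod.ext this.1 this.2

/-- The corner LBTop shows both bits above `bit y`. -/
theorem two_le_card_upArrow_or_bit (hM : Deterministic M) (hP : TilesSubPatterns M P)
    (hLB : ContainsLB P) (y : Bool) :
    2 ≤ (colorClass M (.upArrow y)).card ∨ 2 ≤ (colorClass M (.bit y)).card := by
  by_contra! h
  obtain ⟨T, hT⟩ := hP _ (hLB.lb2_5 y false)
  obtain ⟨T', hT'⟩ := hP _ (hLB.lb2_5 y true)
  have h1 : T 5 4 = T' 5 4 := eq_of_card_le_one (C := colorClass M (.upArrow y)) (by omega)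
    (hT.mem_colorClass (by simp [LBTop]))
    (hT'.mem_colorClass (by simp [LBTop]))
  have h2 : T 6 3 = T' 6 3 := eq_of_card_le_one (C := colorClass M (.bit y)) (by omega)
    (hT.mem_colorClass (by simp [LBTop]))
    (hT'.mem_colorClass (by simp [LBTop]))
  -- If both neighbors were unique, they would determine the corner bit, which takes both values.
  have h3 := hM.eq_of_mem_colorClass (c := .bit false) (c' := .bit true)
    (hT.mem_colorClass (i := 6) (j := 4) (by simp [LBTop]))
    (hT'.mem_colorClass (i := 6) (j := 4) (by simp [LBTop]))
    (by rw [← hT.north (i := 6) (j := 3) (c := .bit y) (c' := .bit false) (by simp [LBTop])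
          (by simp [LBTop]), h2,
          ← hT'.north (i := 6) (j := 3) (c := .bit y) (c' := .bit true) (by simp [LBTop])
          (by simp [LBTop])])
    (by rw [← hT.east (i := 5) (j := 4) (c := .upArrow y) (c' := .bit false) (by simp [LBTop])
          (by simp [LBTop]), h1,
          ← hT'.east (i := 5) (j := 4) (c := .upArrow y) (c' := .bit true) (by simp [LBTop])
          (by simp [LBTop])])
  simp at h3

theorem LBArrow_green {y b on d : Bool} {n m k : ℕ} {c : Color} {e : ℕ → Bool} (hk : k < n) :
    LBArrow y n b on c d m e (5 + k) 2 = some (.green b on) := by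
  unfold LBArrow
  simp only [if_neg (show (2 : ℕ) ≠ 1 by decide), if_true]
  rw [if_neg (by omega), if_neg (by omega), if_pos (by omega)]

theorem LBArrow_variable {y b on d : Bool} {n m k : ℕ} {c : Color} {e : ℕ → Bool} (hk : k < n) :
    LBArrow y n b on c d m e (5 + k) 1 = some c := by
  unfold LBArrow
  simp only [if_true]
  rw [if_pos (by omega)]

theorem LBArrow_el {y b on d : Bool} {n m : ℕ} {c : Color} {e : ℕ → Bool} :
    LBArrow y n b on c d m e (5 + n) 1 = some (.el y) := by
  unfold LBArrow
  simp only [if_true]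
  rw [if_neg (by omega)]

theorem LBArrow_upArrow {y b on d : Bool} {n m : ℕ} {c : Color} {e : ℕ → Bool} :
    LBArrow y n b on c d m e (5 + n) 2 = some (.upArrow y) := by
  unfold LBArrow
  simp only [if_neg (show (2 : ℕ) ≠ 1 by decide), if_true]
  rw [if_neg (by omega), if_neg (by omega), if_neg (by omega)]

theorem LBArrow_ellipsis {y b on d : Bool} {n m k : ℕ} {c : Color} {e : ℕ → Bool} (hk : k < m) :
    LBArrow y n b on c d m e (6 + n + k) 2 = some (.el (e (6 + n + k))) := by
  unfold LBArrow
  simp only [if_neg (show (2 : ℕ) ≠ 1 by decide), if_true]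
  rw [if_neg (by omega), if_neg (by omega), if_neg (by omega), if_neg (by omega), if_pos (by omega)]

theorem LBArrow_end {y b on d : Bool} {n m : ℕ} {c : Color} {e : ℕ → Bool} :
    LBArrow y n b on c d m e (6 + n + m) 2 = some (.bit b) := by
  unfold LBArrow
  simp only [if_neg (show (2 : ℕ) ≠ 1 by decide), if_true]
  rw [if_neg (by omega), if_neg (by omega), if_neg (by omega), if_neg (by omega), if_neg (by omega)]

/-- If the variable color `c` has a unique tile type, and the Greens in `D` have fewer tile types
than they have cells in a row, then they expose different glues to the Up-Arrows. -/
theorem card_le_card_upArrow (hM : Deterministic M) (hP : TilesSubPatterns M P) {y : Bool} {N : ℕ}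
    {c : Color} (hc : (colorClass M c).card ≤ 1)
    (hLB : ∀ b on, ∃ n d m e, N ≤ n ∧ P.Contains (LBArrow y n b on c d m e))
    (D : Finset (Bool × Bool)) (hD : ∀ p ∈ D, (colorClass M (.green p.1 p.2)).card < N) :
    D.card ≤ (colorClass M (.upArrow y)).card := by
  have h : ∀ p : D, ∃ u t g : TileType G G, u ∈ colorClass M (.upArrow y) ∧ t ∈ colorClass M c ∧
      g ∈ colorClass M (.green p.1.1 p.1.2) ∧ t.north = g.south ∧ u.west = g.west := by
    rintro ⟨⟨b, on⟩, hp⟩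
    have hN : (colorClass M (.green b on)).card < N := hD _ hp
    obtain ⟨n, d, m, e, hn, hcont⟩ := hLB b on
    obtain ⟨T, hT⟩ := hP _ hcont
    have hgreen : ∀ k < n, T (5 + k) 2 ∈ colorClass M (.green b on) := fun k hk =>
      hT.mem_colorClass (LBArrow_green hk)
    have hvar : ∀ k < n, T (5 + k) 1 ∈ colorClass M c := fun k hk =>
      hT.mem_colorClass (LBArrow_variable hk)
    have hnorth : ∀ k < n, (T (5 + k) 1).north = (T (5 + k) 2).south := fun k hk =>
      hT.north (LBArrow_variable hk) (LBArrow_green hk)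
    have heast : ∀ k, k + 1 < n → (T (5 + k) 2).east = (T (5 + (k + 1)) 2).west := fun k hk =>
      hT.east (LBArrow_green (by omega)) (LBArrow_green hk)
    -- Above a unique `c` the south input of the Greens is constant, so the row is too long not to
    -- repeat its last tile type.
    obtain ⟨i, hi, he⟩ := exists_eq_last (fun k => T (5 + k) 2) _ n hgreen (by omega) (by
      intro k l hk hl hkl
      refine hM _ (mem_colorClass.1 (hgreen _ hk)).1 _ (mem_colorClass.1 (hgreen _ hl)).1 ?_ ?_
      · rw [← hnorth _ hk, ← hnorth _ hl, eq_of_card_le_one hc (hvar _ hk) (hvar _ hl)]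
      · rw [← heast _ hk, ← heast _ hl]
        exact congrArg TileType.east hkl)
    -- The last Green equals the one at offset `i`, so the glue passed to the Up-Arrow is the one
    -- that entered the Green at offset `i + 1`. Together with the unique `c` below, it identifies
    -- the Green.
    refine ⟨T (5 + n) 2, T (5 + (i + 1)) 1, T (5 + (i + 1)) 2, hT.mem_colorClass LBArrow_upArrow,
      hvar _ hi, hgreen _ hi, hnorth _ hi, ?_⟩
    rw [← heast _ hi]
    have h1 : (T (5 + (n - 1)) 2).east = (T (5 + (n - 1) + 1) 2).west :=
      hT.east (LBArrow_green (by omega))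
        (by rw [show 5 + (n - 1) + 1 = 5 + n by omega]; exact LBArrow_upArrow)
    rw [show 5 + (n - 1) + 1 = 5 + n by omega] at h1
    rw [← h1]
    exact (congrArg TileType.east he).symm
  choose u t g h1 h2 h3 h4 h5 using h
  have := card_index_le (f := u) h1 (by
    intro p p' hpp
    have := hM.eq_of_mem_colorClass (h3 p) (h3 p')
      (by rw [← h4, ← h4, eq_of_card_le_one hc (h2 p) (h2 p')]) (by rw [← h5, ← h5, hpp])
    simp only [Color.green.injEq] at this
    exact Subtype.ext (Prod.ext this.1 this.2))
  simpa using this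

theorem exists_LBArrow (hLB : ContainsLB P) (y b on : Bool) {c : Color} (hc : c.IsVariable) :
    ∃ n d m e, 4 ≤ n ∧ P.Contains (LBArrow y n b on c d m e) := by
  cases y
  · obtain ⟨d, m, e, h⟩ := hLB.lb47_82 b on c hc
    exact ⟨6, d, m, e, by norm_num, h⟩
  · exact hLB.lb83_118 b on c hc

/-- A tile type of Green that is the only one of its color passes its horizontal glue. -/
theorem green_passes (hP : TilesSubPatterns M P) (hLB : ContainsLB P) (y : Bool) {b on : Bool}
    (h1 : (colorClass M (.green b on)).card ≤ 1) {g : TileType G G}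
    (hg : g ∈ colorClass M (.green b on)) :
    g.east = g.west ∧ ∃ u ∈ colorClass M (.upArrow y), u.west = g.west := by
  obtain ⟨n, d, m, e, hn, h⟩ := exists_LBArrow hLB y b on (c := .bit false) (Or.inl rfl)
  obtain ⟨T, hT⟩ := hP _ h
  have hgr : ∀ k < n, T (5 + k) 2 = g := fun k hk =>
    eq_of_card_le_one h1 (hT.mem_colorClass (LBArrow_green hk)) hg
  have he : g.east = g.west := by
    have := hT.east (LBArrow_green (k := 0) (by omega)) (LBArrow_green (k := 1) (by omega))
    rwa [hgr 0 (by omega), hgr 1 (by omega)] at this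
  refine ⟨he, T (5 + n) 2, hT.mem_colorClass LBArrow_upArrow, ?_⟩
  have h2 : (T (5 + (n - 1)) 2).east = (T (5 + (n - 1) + 1) 2).west :=
    hT.east (LBArrow_green (by omega))
      (by rw [show 5 + (n - 1) + 1 = 5 + n by omega]; exact LBArrow_upArrow)
  rw [show 5 + (n - 1) + 1 = 5 + n by omega, hgr _ (by omega)] at h2
  rw [← h2, he]

/-- If the Greens and an Up-Arrow have unique tile types, then the Greens have different south
glues, and all of these are exposed by the variable color. -/
theorem four_le_card_of_green_of_upArrow (hM : Deterministic M) (hP : TilesSubPatterns M P)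
    (hLB : ContainsLB P) (y : Bool) (hG : ∀ b on, (colorClass M (.green b on)).card ≤ 1)
    (hU : (colorClass M (.upArrow y)).card ≤ 1) {c : Color} (hc : c.IsVariable) :
    4 ≤ (colorClass M c).card := by
  have h : ∀ p : Bool × Bool, ∃ t g : TileType G G, t ∈ colorClass M c ∧
      g ∈ colorClass M (.green p.1 p.2) ∧ t.north = g.south := by
    rintro ⟨b, on⟩
    obtain ⟨T, hT⟩ := hP _ (hLB.lb6_41 y b on c hc)
    exact ⟨T 2 1, T 2 2, hT.mem_colorClass (by simp [LBGreen]), hT.mem_colorClass (by simp [LBGreen]),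
      hT.north (c := c) (c' := .green b on) (by simp [LBGreen]) (by simp [LBGreen])⟩
  choose t g h1 h2 h3 using h
  refine card_index_le (f := t) h1 ?_
  intro p p' hpp
  -- Both Greens share the west glue of the single Up-Arrow type, so only their south glues can tell
  -- them apart.
  obtain ⟨-, u, hu, hu'⟩ := green_passes hP hLB y (hG _ _) (h2 p)
  obtain ⟨-, v, hv, hv'⟩ := green_passes hP hLB y (hG _ _) (h2 p')
  have := hM.eq_of_mem_colorClass (h2 p) (h2 p') (by rw [← h3, ← h3, hpp])
    (by rw [← hu', ← hv', eq_of_card_le_one hU hu hv])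
  simp only [Color.green.injEq] at this
  exact Prod.ext this.1 this.2

/-! ### Bits and Carry Blue -/

theorem LB42_carry {β : Bool → Color} {i j : ℕ} (hi : i = 2 ∨ i = 5 ∨ i = 7 ∨ i = 9) (h1 : 1 ≤ j)
    (h2 : j ≤ 5) : LB42 β i j = some .carry := by
  unfold LB42
  rw [if_pos (by omega), if_pos hi]

theorem LB42_left {β : Bool → Color} {i j : ℕ} (hi : i = 1 ∨ i = 3 ∨ i = 4 ∨ i = 6) (h1 : 1 ≤ j)
    (h2 : j ≤ 5) : LB42 β i j = some (β (decide (j = 3 ∨ j = 4))) := by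
  unfold LB42
  rw [if_pos (by omega), if_neg (by omega), if_pos (by omega)]

theorem LB42_right {β : Bool → Color} {i j : ℕ} (hi : i = 8 ∨ i = 10) (h1 : 1 ≤ j)
    (h2 : j ≤ 5) : LB42 β i j = some (β (decide (j = 1 ∨ j = 2 ∨ j = 4))) := by
  unfold LB42
  rw [if_pos (by omega), if_neg (by omega), if_neg (by omega)]

/-- The glues of bits that have unique tile types. -/
theorem exists_bit_glues (hM : Deterministic M) {β : Bool → Color} (hβ : β false ≠ β true)
    {T : ℕ → ℕ → TileType G G} (hT : IsTiling M (LB42 β) T)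
    (h1 : ∀ x, (colorClass M (β x)).card ≤ 1) :
    ∃ (v : G) (h : Bool → G), Function.Injective h ∧ ∀ x, ∀ t ∈ colorClass M (β x),
      t = ⟨v, v, h x, h x, β x⟩ := by
  have m0 : T 3 1 ∈ colorClass M (β false) :=
    hT.mem_colorClass (LB42_left (by omega) le_rfl (by omega))
  have m1 : T 3 3 ∈ colorClass M (β true) :=
    hT.mem_colorClass (LB42_left (by omega) (by omega) (by omega))
  have e2 : T 3 2 = T 3 1 := eq_of_card_le_one (h1 false)
    (hT.mem_colorClass (LB42_left (by omega) (by omega) (by omega))) m0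
  have e5 : T 3 5 = T 3 1 := eq_of_card_le_one (h1 false)
    (hT.mem_colorClass (LB42_left (by omega) (by omega) (by omega))) m0
  have e4 : T 3 4 = T 3 3 := eq_of_card_le_one (h1 true)
    (hT.mem_colorClass (LB42_left (by omega) (by omega) (by omega))) m1
  have f1 : T 4 1 = T 3 1 := eq_of_card_le_one (h1 false)
    (hT.mem_colorClass (LB42_left (by omega) (by omega) (by omega))) m0
  have f3 : T 4 3 = T 3 3 := eq_of_card_le_one (h1 true)
    (hT.mem_colorClass (LB42_left (by omega) (by omega) (by omega))) m1
  -- Columns 3 and 4 are equal and adjacent, so each bit passes its horizontal glue. The vertical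
  -- successions 00, 01 and 11 identify all vertical glues.
  have n : ∀ j, 1 ≤ j → j + 1 ≤ 5 → (T 3 j).north = (T 3 (j + 1)).south := fun j hj hj' =>
    hT.north (LB42_left (by omega) hj (by omega)) (LB42_left (by omega) (by omega) hj')
  have w : ∀ j, 1 ≤ j → j ≤ 5 → (T 3 j).east = (T 4 j).west := fun j hj hj' =>
    hT.east (LB42_left (by omega) hj hj') (LB42_left (by omega) hj hj')
  have n1 := n 1 (by omega) (by omega)
  have n2 := n 2 (by omega) (by omega)
  have n3 := n 3 (by omega) (by omega)
  have n4 := n 4 (by omega) (by omega)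
  have w1 := w 1 (by omega) (by omega)
  have w3 := w 3 (by omega) (by omega)
  norm_num [e2, e4, e5, f1, f3] at n1 n2 n3 n4 w1 w3
  refine ⟨(T 3 1).north, fun x => if x then (T 3 3).west else (T 3 1).west, ?_, ?_⟩
  · have hne : (T 3 1).west ≠ (T 3 3).west := fun h =>
      hβ (hM.eq_of_mem_colorClass m0 m1 (by rw [← n1, n2]) h)
    intro x x' h
    cases x <;> cases x' <;> simp_all
  · intro x t ht
    cases x
    · rw [eq_of_card_le_one (h1 false) ht m0]
      ext1 <;> simp [n1, w1, (mem_colorClass.1 m0).2]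
    · rw [eq_of_card_le_one (h1 true) ht m1]
      ext1 <;> simp [n2, n3, w3, (mem_colorClass.1 m1).2]

/-- If a copy of Black and White has unique tile types, then Carry Blue computes all pairs of
horizontal bits. -/
theorem exists_carry (hM : Deterministic M) {β : Bool → Color} (hβ : β false ≠ β true)
    (hP : TilesSubPatterns M P) (hLB : P.Contains (LB42 β))
    (h1 : ∀ x, (colorClass M (β x)).card ≤ 1) :
    4 ≤ (colorClass M .carry).card ∧ ∃ (v : G) (h : Bool → G), Function.Injective h ∧
      (∀ x, ∀ t ∈ colorClass M (β x), t = ⟨v, v, h x, h x, β x⟩) ∧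
      ((colorClass M .carry).card ≤ 4 → ∃ κ : Bool → G,
        (∀ x y, ⟨κ (borrow x y), κ y, h (xor x y), h x, .carry⟩ ∈ M) ∧
        ∀ t ∈ colorClass M .carry, ∃ x y,
          t = ⟨κ (borrow x y), κ y, h (xor x y), h x, .carry⟩) := by
  obtain ⟨T, hT⟩ := hP _ hLB
  obtain ⟨v, h, hinj, hbit⟩ := exists_bit_glues hM hβ hT h1
  have hl : ∀ i j, (i = 1 ∨ i = 3 ∨ i = 4 ∨ i = 6) → 1 ≤ j → j ≤ 5 →
      T i j = ⟨v, v, h (decide (j = 3 ∨ j = 4)), h (decide (j = 3 ∨ j = 4)), _⟩ :=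
    fun i j hi hj hj' => hbit _ _ (hT.mem_colorClass (LB42_left hi hj hj'))
  have hr : ∀ i j, (i = 8 ∨ i = 10) → 1 ≤ j → j ≤ 5 →
      T i j = ⟨v, v, h (decide (j = 1 ∨ j = 2 ∨ j = 4)), h (decide (j = 1 ∨ j = 2 ∨ j = 4)), _⟩ :=
    fun i j hi hj hj' => hbit _ _ (hT.mem_colorClass (LB42_right hi hj hj'))
  have hc : ∀ i j, (i = 5 ∨ i = 7) → 1 ≤ j → j ≤ 5 → T i j ∈ colorClass M .carry :=
    fun i j hi hj hj' => hT.mem_colorClass (LB42_carry (by omega) hj hj')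
  have w5 : ∀ j, 1 ≤ j → j ≤ 5 → (T 5 j).west = h (decide (j = 3 ∨ j = 4)) := by
    intro j hj hj'
    rw [← hT.east (i := 4) (LB42_left (by omega) hj hj') (LB42_carry (by omega) hj hj'),
      hl 4 j (by omega) hj hj']
  have w7 : ∀ j, 1 ≤ j → j ≤ 5 → (T 7 j).west = h (decide (j = 3 ∨ j = 4)) := by
    intro j hj hj'
    rw [← hT.east (i := 6) (LB42_left (by omega) hj hj') (LB42_carry (by omega) hj hj'),
      hl 6 j (by omega) hj hj']
  have e5 : ∀ j, 1 ≤ j → j ≤ 5 → (T 5 j).east = h (decide (j = 3 ∨ j = 4)) := by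
    intro j hj hj'
    rw [hT.east (LB42_carry (by omega) hj hj') (LB42_left (by omega) hj hj'),
      hl 6 j (by omega) hj hj']
  have e7 : ∀ j, 1 ≤ j → j ≤ 5 → (T 7 j).east = h (decide (j = 1 ∨ j = 2 ∨ j = 4)) := by
    intro j hj hj'
    rw [hT.east (LB42_carry (by omega) hj hj') (LB42_right (by omega) hj hj'),
      hr 8 j (by omega) hj hj']
  have n : ∀ i j, (i = 5 ∨ i = 7) → 1 ≤ j → j + 1 ≤ 5 → (T i j).north = (T i (j + 1)).south :=
    fun i j hi hj hj' =>
      hT.north (LB42_carry (by omega) hj (by omega)) (LB42_carry (by omega) (by omega) hj')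
  -- `f x z` has west glue `h x` and east glue `h z`
  let f : Bool × Bool → TileType G G := fun p =>
    match p with
    | (false, false) => T 5 1
    | (true, true) => T 5 3
    | (false, true) => T 7 1
    | (true, false) => T 7 3
  have fc : ∀ p, f p ∈ colorClass M .carry := by
    rintro ⟨_ | _, _ | _⟩ <;> exact hc _ _ (by omega) (by omega) (by omega)
  have fw : ∀ p, (f p).west = h p.1 := by
    rintro ⟨_ | _, _ | _⟩ <;> simp [f, w5, w7]
  have fe : ∀ p, (f p).east = h p.2 := by
    rintro ⟨_ | _, _ | _⟩ <;> simp [f, e5, e7]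
  have finj : Function.Injective f := by
    intro p q hpq
    refine Prod.ext (hinj ?_) (hinj ?_)
    · rw [← fw, ← fw, hpq]
    · rw [← fe, ← fe, hpq]
  refine ⟨card_index_le fc finj, v, h, hinj, hbit, fun h4 => ?_⟩
  -- With only four types, the west and east bits determine the Carry Blue tile, so all of columns 5
  -- and 7 is known.
  have huniq : ∀ t ∈ colorClass M .carry, ∀ x z, t.west = h x → t.east = h z → t = f (x, z) := by
    intro t ht x z hx hz
    obtain ⟨⟨x', z'⟩, rfl⟩ := exists_eq_of_card_le fc finj (by simpa using h4) ht
    rw [fw] at hx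
    rw [fe] at hz
    rw [← hinj hx, ← hinj hz]
  have u (i j) (hi : i = 5 ∨ i = 7) (hj : 1 ≤ j) (hj' : j ≤ 5) := huniq _ (hc i j hi hj hj')
  have u52 : T 5 2 = f (false, false) := u 5 2 (by omega) (by omega) (by omega) _ _
    (w5 2 (by omega) (by omega)) (e5 2 (by omega) (by omega))
  have u54 : T 5 4 = f (true, true) := u 5 4 (by omega) (by omega) (by omega) _ _
    (w5 4 (by omega) (by omega)) (e5 4 (by omega) (by omega))
  have u72 : T 7 2 = f (false, true) := u 7 2 (by omega) (by omega) (by omega) _ _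
    (w7 2 (by omega) (by omega)) (e7 2 (by omega) (by omega))
  have u74 : T 7 4 = f (true, true) := u 7 4 (by omega) (by omega) (by omega) _ _
    (w7 4 (by omega) (by omega)) (e7 4 (by omega) (by omega))
  have n51 : (f (false, false)).north = (T 5 2).south := n 5 1 (by omega) (by omega) (by omega)
  have n52 : (T 5 2).north = (f (true, true)).south := n 5 2 (by omega) (by omega) (by omega)
  have n53 : (f (true, true)).north = (T 5 4).south := n 5 3 (by omega) (by omega) (by omega)
  have n71 : (f (false, true)).north = (T 7 2).south := n 7 1 (by omega) (by omega) (by omega)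
  have n72 : (T 7 2).north = (f (true, false)).south := n 7 2 (by omega) (by omega) (by omega)
  have n73 : (f (true, false)).north = (T 7 4).south := n 7 3 (by omega) (by omega) (by omega)
  rw [u52] at n51 n52
  rw [u54] at n53
  rw [u72] at n71 n72
  rw [u74] at n73
  let κ : Bool → G := fun y => (f (false, y)).south
  -- Column 5 reads 00, 00, 11, 11 and column 7 reads 01, 01, 10, 11 as (west, east) bits. The
  -- vertical matches leave two classes of glues, one for each borrow bit. That these two glues
  -- differ is not needed here; it follows from determinism later.
  have hf : ∀ x y, f (x, xor x y) = ⟨κ (borrow x y), κ y, h (xor x y), h x, .carry⟩ := by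
    intro x y
    have hcol := (mem_colorClass.1 (fc (x, xor x y))).2
    have hw := fw (x, xor x y)
    have he := fe (x, xor x y)
    ext1
    · cases x <;> cases y <;> simp [κ, borrow, n51, n71, n73, ← n52, n53]
    · cases x <;> cases y <;> simp [κ, ← n51, ← n52, ← n71, ← n72]
    · exact he
    · exact hw
    · exact hcol
  refine ⟨κ, fun x y => ?_, fun t ht => ?_⟩
  · rw [← hf]
    exact (mem_colorClass.1 (fc _)).1
  · obtain ⟨⟨x, z⟩, rfl⟩ := exists_eq_of_card_le fc finj (by simpa using h4) ht
    refine ⟨x, xor x z, ?_⟩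
    rw [← hf]
    congr
    cases x <;> cases z <;> rfl

/-! ### The minimum number of tile types -/

theorem one_le_card_colorClass (hP : TilesSubPatterns M P) (hLB : ContainsLB P) (c : Color) :
    1 ≤ (colorClass M c).card := by
  have key : ∀ F i j, P.Contains F → F i j = some c → 1 ≤ (colorClass M c).card := by
    intro F i j hF hc
    obtain ⟨T, hT⟩ := hP F hF
    exact Finset.card_pos.2 ⟨_, hT.mem_colorClass hc⟩
  cases c with
  | bit b => exact key _ 6 3 (hLB.lb2_5 b b) (by simp [LBTop])
  | carry => exact key _ 2 1 hLB.lb42 (LB42_carry (by omega) le_rfl (by omega))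
  | el b =>
    cases b
    · exact key _ 2 1 hLB.lb1 (by simp [LB1])
    · exact key _ 4 1 hLB.lb1 (by simp [LB1])
  | rightArrow b =>
    exact key _ 1 2 (hLB.lb6_41 b b b (.bit false) (Or.inl rfl)) (by simp [LBGreen])
  | upArrow b => exact key _ 5 4 (hLB.lb2_5 b b) (by simp [LBTop])
  | green b on => exact key _ 1 1 (hLB.lb6_15 b on) (by simp [LBGreenBlack])
  | purple i =>
    exact key _ 2 1 (hLB.lb6_41 false false false (.purple i) (Or.inr ⟨i, rfl⟩)) (by simp [LBGreen])
  | bitCopy i b =>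
    cases b
    · exact key _ 1 1 (hLB.lb43_46 i) (by simp [LB42])
    · exact key _ 8 1 (hLB.lb43_46 i) (by simp [LB42])

theorem two_le_card_of_LB1 (hM : Deterministic M) (hP : TilesSubPatterns M P)
    (hLB : ContainsLB P) (hB : (colorClass M (.bit false)).card < 19) :
    2 ≤ (colorClass M .carry).card ∧ ∀ y, 2 ≤ (colorClass M (.el y)).card := by
  obtain ⟨T, hT⟩ := hP _ hLB.lb1
  refine ⟨?_, fun y => ?_⟩ <;> by_contra! h
  · exact absurd (card_black_of_LB1 hM hT (i := 6) (by omega) (by simpa using Nat.le_of_lt_succ h))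
      (by omega)
  · cases y
    · exact absurd (card_black_of_LB1 hM hT (i := 2) (by omega)
        (by simpa using Nat.le_of_lt_succ h)) (by omega)
    · exact absurd (card_black_of_LB1 hM hT (i := 4) (by omega)
        (by simpa using Nat.le_of_lt_succ h)) (by omega)

/-- Either Carry Blue has four tile types, or no copy of Black and White is unique. -/
theorem four_le_card_carry_or (hM : Deterministic M) (hP : TilesSubPatterns M P)
    (hLB : ContainsLB P) :
    4 ≤ (colorClass M .carry).card ∨
      (3 ≤ (colorClass M (.bit false)).card + (colorClass M (.bit true)).card ∧
        12 ≤ ∑ i, ∑ b, (colorClass M (.bitCopy i b)).card) := by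
  by_cases h4 : 4 ≤ (colorClass M .carry).card
  · exact Or.inl h4
  have key : ∀ β : Bool → Color, β false ≠ β true → P.Contains (LB42 β) →
      3 ≤ (colorClass M (β false)).card + (colorClass M (β true)).card := by
    intro β hβ hF
    have h0 := one_le_card_colorClass hP hLB (β false)
    have h1 := one_le_card_colorClass hP hLB (β true)
    by_contra! h
    exact h4 (exists_carry hM hβ hP hF (fun x => by cases x <;> omega)).1
  refine Or.inr ⟨key _ (by simp) hLB.lb42, ?_⟩
  have : ∀ i, 3 ≤ ∑ b, (colorClass M (.bitCopy i b)).card := by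
    intro i
    have := key _ (by simp) (hLB.lb43_46 i)
    rw [Fintype.sum_bool]
    omega
  simpa using Finset.card_nsmul_le_sum Finset.univ _ 3 (fun i _ => this i)

/-- Few tile types of Greens force many tile types of Up-Arrows. -/
theorem card_upArrow_of_green (hM : Deterministic M) (hP : TilesSubPatterns M P) {y : Bool}
    {N : ℕ} {c : Color} (hc : (colorClass M c).card ≤ 1)
    (hLB : ∀ b on, ∃ n d m e, N ≤ n ∧ P.Contains (LBArrow y n b on c d m e))
    (h1 : ∀ b on, 1 ≤ (colorClass M (.green b on)).card) :
    (∑ b, ∑ on, (colorClass M (.green b on)).card < N + 3 →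
      4 ≤ (colorClass M (.upArrow y)).card) ∧
    (∑ b, ∑ on, (colorClass M (.green b on)).card < 2 * N + 2 →
      3 ≤ (colorClass M (.upArrow y)).card) := by
  have g00 := h1 false false
  have g01 := h1 false true
  have g10 := h1 true false
  have g11 := h1 true true
  have h4 : (∀ b on, (colorClass M (.green b on)).card < N) →
      4 ≤ (colorClass M (.upArrow y)).card := fun h => by
    simpa using card_le_card_upArrow hM hP hc hLB Finset.univ (fun p _ => h _ _)
  simp only [Fintype.sum_bool]
  refine ⟨fun hs => h4 ?_, fun hs => ?_⟩
  · rintro (_ | _) (_ | _) <;> omega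
  -- At most one Green can have `N` types under this bound; discarding it leaves three that are
  -- distinguished by the Up-Arrows.
  by_cases h : ∀ b on, (colorClass M (.green b on)).card < N
  · exact le_trans (by norm_num) (h4 h)
  push Not at h
  obtain ⟨b, on, hb⟩ := h
  have := card_le_card_upArrow hM hP hc hLB (Finset.univ.erase (b, on)) (by
    rintro ⟨b', on'⟩ hq
    have hne := Finset.ne_of_mem_erase hq
    by_contra! hb'
    cases b <;> cases on <;> cases b' <;> cases on' <;> first | exact hne rfl | (dsimp at hb'; omega))
  simpa using this

/-- The numbers of tile types of each color in a minimum tile type set. -/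
structure HasDesignedCounts (M : Finset (TileType G G)) : Prop where
  card : M.card = 46
  bit : ∀ x, (colorClass M (.bit x)).card ≤ 1
  carry : (colorClass M .carry).card ≤ 4
  el : ∀ y, (colorClass M (.el y)).card ≤ 2
  rightArrow : ∀ y, (colorClass M (.rightArrow y)).card ≤ 4
  upArrow : ∀ y, (colorClass M (.upArrow y)).card ≤ 4
  green : ∀ b on, (colorClass M (.green b on)).card ≤ 1

/-- If some Purple has a unique type, it serves as the variable color and the lower bounds add up to
46, so all are attained. Otherwise the Purples take 16 types, and the remaining budget is too small.
-/
theorem hasDesignedCounts (hM : Deterministic M) (hP : TilesSubPatterns M P)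
    (hLB : ContainsLB P) (h46 : M.card ≤ 46) : HasDesignedCounts M := by
  have hsum := card_eq_sum_colorClass M
  have h1 := one_le_card_colorClass (M := M) hP hLB
  have hcopy8 : 8 ≤ ∑ i, ∑ b, (colorClass M (.bitCopy i b)).card := by
    have : ∀ i, 2 ≤ ∑ b, (colorClass M (.bitCopy i b)).card := by
      intro i
      have := h1 (.bitCopy i true)
      have := h1 (.bitCopy i false)
      rw [Fintype.sum_bool]
      omega
    simpa using Finset.card_nsmul_le_sum Finset.univ _ 2 (fun i _ => this i)
  have hpurple : ∀ k, (∀ i, k ≤ (colorClass M (.purple i)).card) →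
      8 * k ≤ ∑ i, (colorClass M (.purple i)).card := by
    intro k hk
    simpa using Finset.card_nsmul_le_sum Finset.univ _ k (fun i _ => hk i)
  have hp8 := hpurple 1 fun i => h1 _
  have hcarry := four_le_card_carry_or hM hP hLB
  simp only [Fintype.sum_bool] at hsum hcopy8 hcarry
  have b0 := h1 (.bit false)
  have b1 := h1 (.bit true)
  have c1 := h1 .carry
  have e0 := h1 (.el false)
  have e1 := h1 (.el true)
  have r0 := h1 (.rightArrow false)
  have r1 := h1 (.rightArrow true)
  have u0 := h1 (.upArrow false)
  have u1 := h1 (.upArrow true)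
  have g00 := h1 (.green false false)
  have g01 := h1 (.green false true)
  have g10 := h1 (.green true false)
  have g11 := h1 (.green true true)
  -- The other 28 colors all occur, which leaves at most 18 types for Black.
  obtain ⟨c2, e2⟩ := two_le_card_of_LB1 hM hP hLB (by omega)
  have e20 := e2 false
  have e21 := e2 true
  by_cases hs : ∃ i, (colorClass M (.purple i)).card ≤ 1
  · obtain ⟨i, hi⟩ := hs
    have hv : (Color.purple i).IsVariable := Or.inr ⟨i, rfl⟩
    have hr : ∀ y, 4 ≤ (colorClass M (.rightArrow y)).card := by
      intro y
      have h4 := four_le_card_mul_card_rightArrow hM hP hLB y hv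
      exact h4.trans (by simpa using Nat.mul_le_mul_right _ hi)
    have hr0 := hr false
    have hr1 := hr true
    obtain ⟨hU0, hU0'⟩ := card_upArrow_of_green hM hP (y := false) (N := 6) hi (by
      intro b on
      obtain ⟨d, m, e, h⟩ := hLB.lb47_82 b on _ hv
      exact ⟨6, d, m, e, le_rfl, h⟩) (fun b on => h1 _)
    obtain ⟨hU1, hU1'⟩ := card_upArrow_of_green hM hP (y := true) (N := 4) hi
      (fun b on => hLB.lb83_118 b on _ hv) (fun b on => h1 _)
    simp only [Fintype.sum_bool] at hU0 hU0' hU1 hU1'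
    have hrest : 11 + 2 + 4 + 8 + 8 ≤ (colorClass M .carry).card +
        ((colorClass M (.bit true)).card + (colorClass M (.bit false)).card) +
        ((colorClass M (.el true)).card + (colorClass M (.el false)).card) +
        ((colorClass M (.rightArrow true)).card + (colorClass M (.rightArrow false)).card) +
        ∑ i, (colorClass M (.purple i)).card +
        ∑ i, ((colorClass M (.bitCopy i true)).card + (colorClass M (.bitCopy i false)).card) := by
      omega
    -- The other colors take at least 34 types, so Greens and Up-Arrows share 12. The bounds
    -- bootstrap: the Greens have successively at most 10, 8, 7 and 5 types, below the thresholds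
    -- 14, 9, 10 and 7. The second threshold, reached when only one UAW is known, is why RAB rows
    -- have six Greens.
    have hu0 : 3 ≤ (colorClass M (.upArrow false)).card := hU0' (by omega)
    have hu0' : 4 ≤ (colorClass M (.upArrow false)).card := hU0 (by omega)
    have hu1 : 3 ≤ (colorClass M (.upArrow true)).card := hU1' (by omega)
    have hu1' : 4 ≤ (colorClass M (.upArrow true)).card := hU1 (by omega)
    clear hU0 hU0' hU1 hU1'
    have hc4 : 4 ≤ (colorClass M .carry).card := by omega
    clear hcarry
    exact
      { card := by omega
        bit := by rintro (_ | _) <;> omega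
        carry := by omega
        el := by rintro (_ | _) <;> omega
        rightArrow := by rintro (_ | _) <;> omega
        upArrow := by rintro (_ | _) <;> omega
        green := by rintro (_ | _) (_ | _) <;> omega }
  · exfalso
    push Not at hs
    have hp16 := hpurple 2 fun i => hs i
    have hr : ∀ y, 2 ≤ (colorClass M (.rightArrow y)).card := by
      intro y
      by_contra! hlt
      have := hpurple 4 fun i => (four_le_card_mul_card_rightArrow hM hP hLB y (c := .purple i)
        (Or.inr ⟨i, rfl⟩)).trans (by simpa using Nat.mul_le_mul_left _ (Nat.le_of_lt_succ hlt))
      omega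
    have hr0 := hr false
    have hr1 := hr true
    -- A unique Black, being a variable color as well, would force four types of each Right-Arrow.
    have hb2 : 2 ≤ (colorClass M (.bit false)).card := by
      by_contra! hlt
      have := (four_le_card_mul_card_rightArrow hM hP hLB false (c := .bit false) (Or.inl rfl)).trans
        (Nat.mul_le_mul_right _ (Nat.le_of_lt_succ hlt))
      have := (four_le_card_mul_card_rightArrow hM hP hLB true (c := .bit false) (Or.inl rfl)).trans
        (Nat.mul_le_mul_right _ (Nat.le_of_lt_succ hlt))
      omega
    -- This last extra type brings the total to 46, so the Greens and UAB must be unique; then every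
    -- Purple needs four types.
    have hu := two_le_card_upArrow_or_bit hM hP hLB true
    have hG : ∀ b on, (colorClass M (.green b on)).card ≤ 1 := by
      rintro (_ | _) (_ | _) <;> omega
    have hU : (colorClass M (.upArrow false)).card ≤ 1 := by omega
    have := hpurple 4 fun i => four_le_card_of_green_of_upArrow hM hP hLB false hG hU
      (c := .purple i) (Or.inr ⟨i, rfl⟩)
    omega

/-! ### The glues of a minimum tile type set -/

theorem exists_el (hP : TilesSubPatterns M P) (hLB : ContainsLB P) {v : G} {h : Bool → G}
    (hinj : Function.Injective h)
    (hbit : ∀ x, ∀ t ∈ colorClass M (.bit x), t = ⟨v, v, h x, h x, .bit x⟩) {y : Bool}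
    (h2 : (colorClass M (.el y)).card ≤ 2) :
    ∃ π : G, (∀ x, ⟨π, π, h x, h x, .el y⟩ ∈ M) ∧
      ∀ t ∈ colorClass M (.el y), ∃ x, t = ⟨π, π, h x, h x, .el y⟩ := by
  obtain ⟨T, hT⟩ := hP _ hLB.lb1
  obtain ⟨q, hl, hc, hr⟩ : ∃ q, (∀ j, 1 ≤ j → j ≤ 21 → LB1 q j = some (.bit (decide (j = 20)))) ∧
      (∀ j, 1 ≤ j → j ≤ 21 → LB1 (q + 1) j = some (.el y)) ∧
      ∀ j, 1 ≤ j → j ≤ 21 → LB1 (q + 2) j = some (.bit (decide (j = 20))) := by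
    cases y
    · exact ⟨1, fun j => LB1_odd (by omega), fun j => LB1_even (by omega),
        fun j => LB1_odd (by omega)⟩
    · exact ⟨3, fun j => LB1_odd (by omega), fun j => LB1_even (by omega),
        fun j => LB1_odd (by omega)⟩
  have hw : ∀ j, 1 ≤ j → j ≤ 21 → (T (q + 1) j).west = h (decide (j = 20)) := by
    intro j hj hj'
    rw [← hT.east (hl j hj hj') (hc j hj hj'), hbit _ _ (hT.mem_colorClass (hl j hj hj'))]
  have he : ∀ j, 1 ≤ j → j ≤ 21 → (T (q + 1) j).east = h (decide (j = 20)) := by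
    intro j hj hj'
    rw [hT.east (hc j hj hj') (hr j hj hj'), hbit _ _ (hT.mem_colorClass (hr j hj hj'))]
  have hmem : ∀ j, 1 ≤ j → j ≤ 21 → T (q + 1) j ∈ colorClass M (.el y) := fun j hj hj' =>
    hT.mem_colorClass (hc j hj hj')
  have hn : ∀ j, 1 ≤ j → j + 1 ≤ 21 → (T (q + 1) j).north = (T (q + 1) (j + 1)).south :=
    fun j hj hj' => hT.north (hc j hj (by omega)) (hc _ (by omega) hj')
  let f : Bool → TileType G G := fun x => T (q + 1) (if x then 20 else 1)
  have fm : ∀ x, f x ∈ colorClass M (.el y) := by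
    rintro (_ | _) <;> exact hmem _ (by simp) (by simp)
  have fw : ∀ x, (f x).west = h x := by
    rintro (_ | _) <;> simp [f, hw]
  have fe : ∀ x, (f x).east = h x := by
    rintro (_ | _) <;> simp [f, he]
  have finj : Function.Injective f := fun x x' hx => hinj (by rw [← fw, ← fw, hx])
  have hT' : ∀ j, 1 ≤ j → j ≤ 21 → T (q + 1) j = f (decide (j = 20)) := by
    intro j hj hj'
    obtain ⟨x, hx⟩ := exists_eq_of_card_le fm finj (by simpa using h2) (hmem j hj hj')
    have := hw j hj hj'
    rw [hx, fw] at this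
    rw [hx, hinj this]
  -- The successions 00, 01 and 10 around the White row 20 identify the vertical glues of both
  -- types.
  have n1 := hn 1 (by omega) (by omega)
  have n19 := hn 19 (by omega) (by omega)
  have n20 := hn 20 (by omega) (by omega)
  rw [hT' _ (by omega) (by omega), hT' _ (by omega) (by omega)] at n1 n19 n20
  norm_num at n1 n19 n20
  have hf : ∀ x, f x = ⟨(f false).south, (f false).south, h x, h x, .el y⟩ := by
    intro x
    ext1
    · cases x
      · exact n1
      · exact n20
    · cases x
      · rfl
      · exact n19.symm.trans n1
    · exact fe x
    · exact fw x
    · exact (mem_colorClass.1 (fm x)).2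
  refine ⟨(f false).south, fun x => ?_, fun t ht => ?_⟩
  · rw [← hf]
    exact (mem_colorClass.1 (fm x)).1
  · obtain ⟨x, rfl⟩ := exists_eq_of_card_le fm finj (by simpa using h2) ht
    exact ⟨x, hf x⟩

/-- Black below and Black above give both vertical glues of a Green; uniqueness makes its horizontal
glues equal. -/
theorem exists_green (hP : TilesSubPatterns M P) (hLB : ContainsLB P) {v : G} {h : Bool → G}
    (hbit : ∀ x, ∀ t ∈ colorClass M (.bit x), t = ⟨v, v, h x, h x, .bit x⟩) {b on : Bool}
    (h1 : (colorClass M (.green b on)).card ≤ 1) :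
    ∃ τ : G, ⟨v, v, τ, τ, .green b on⟩ ∈ M ∧
      ∀ t ∈ colorClass M (.green b on), t = ⟨v, v, τ, τ, .green b on⟩ := by
  obtain ⟨T, hT⟩ := hP _ (hLB.lb6_41 false b on (.bit false) (Or.inl rfl))
  obtain ⟨T', hT'⟩ := hP _ (hLB.lb6_15 b on)
  have hg : T 2 2 ∈ colorClass M (.green b on) := hT.mem_colorClass (by simp [LBGreen])
  have hg' : T' 1 1 = T 2 2 :=
    eq_of_card_le_one h1 (hT'.mem_colorClass (by simp [LBGreenBlack])) hg
  have hs := hT.north (i := 2) (j := 1) (c := .bit false) (c' := .green b on)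
    (by simp [LBGreen]) (by simp [LBGreen])
  rw [hbit false (T 2 1) (hT.mem_colorClass (by simp [LBGreen]))] at hs
  have hn := hT'.north (i := 1) (j := 1) (c := .green b on) (c' := .bit false)
    (by simp [LBGreenBlack]) (by simp [LBGreenBlack])
  rw [hbit false (T' 1 (1 + 1)) (hT'.mem_colorClass (by simp [LBGreenBlack])), hg'] at hn
  have key : T 2 2 = ⟨v, v, (T 2 2).west, (T 2 2).west, .green b on⟩ := by
    ext1
    · exact hn
    · exact hs.symm
    · exact (green_passes hP hLB false h1 hg).1
    · rfl
    · exact (mem_colorClass.1 hg).2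
  refine ⟨(T 2 2).west, ?_, fun t ht => ?_⟩
  · rw [← key]
    exact (mem_colorClass.1 hg).1
  · rw [← key]
    exact eq_of_card_le_one h1 ht hg

/-- The glues of the tile types of Black, White, Carry Blue, el-Black, el-White and the Greens. -/
structure HasGlues (M : Finset (TileType G G)) (v : G) (h κ π : Bool → G) (τ : Bool → Bool → G) :
    Prop where
  injective : Function.Injective h
  bit : ∀ x, ∀ t ∈ colorClass M (.bit x), t = ⟨v, v, h x, h x, .bit x⟩
  bit_mem : ∀ x, ⟨v, v, h x, h x, .bit x⟩ ∈ M
  carry : ∀ t ∈ colorClass M .carry, ∃ x y, t = ⟨κ (borrow x y), κ y, h (xor x y), h x, .carry⟩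
  carry_mem : ∀ x y, ⟨κ (borrow x y), κ y, h (xor x y), h x, .carry⟩ ∈ M
  el : ∀ y, ∀ t ∈ colorClass M (.el y), ∃ x, t = ⟨π y, π y, h x, h x, .el y⟩
  el_mem : ∀ y x, ⟨π y, π y, h x, h x, .el y⟩ ∈ M
  green : ∀ b on, ∀ t ∈ colorClass M (.green b on), t = ⟨v, v, τ b on, τ b on, .green b on⟩
  green_mem : ∀ b on, ⟨v, v, τ b on, τ b on, .green b on⟩ ∈ M

theorem HasDesignedCounts.exists_hasGlues (hC : HasDesignedCounts M) (hM : Deterministic M)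
    (hP : TilesSubPatterns M P) (hLB : ContainsLB P) : ∃ v h κ π τ, HasGlues M v h κ π τ := by
  obtain ⟨-, v, h, hinj, hbit, hcarry⟩ := exists_carry hM (by simp) hP hLB.lb42 hC.bit
  obtain ⟨κ, hκ, hκ'⟩ := hcarry hC.carry
  choose π hπ hπ' using fun y => exists_el hP hLB hinj hbit (hC.el y)
  choose τ hτ hτ' using fun b on => exists_green hP hLB hbit (hC.green b on)
  refine ⟨v, h, κ, π, τ, hinj, hbit, fun x => ?_, hκ', hκ, hπ', hπ, hτ', hτ⟩
  obtain ⟨t, ht⟩ := Finset.card_pos.1 (one_le_card_colorClass hP hLB (.bit x))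
  rw [← hbit x t ht]
  exact (mem_colorClass.1 ht).1

/-- All Greens share the south glue `v`, so their west glues must distinguish them. -/
theorem HasGlues.green_injective {v : G} {h κ π : Bool → G} {τ : Bool → Bool → G}
    (hG : HasGlues M v h κ π τ) (hM : Deterministic M) {b b' on on' : Bool}
    (he : τ b on = τ b' on') : b = b' ∧ on = on' := by
  have := congrArg TileType.color (hM _ (hG.green_mem b on) _ (hG.green_mem b' on') rfl he)
  simpa using this

/-! ### Glues of the Up-Arrows and Right-Arrows -/

/-- An Up-Arrow and a Right-Arrow next to Greens. -/
theorem HasGlues.exists_arrows {v : G} {h κ π : Bool → G} {τ : Bool → Bool → G}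
    (hG : HasGlues M v h κ π τ) (hP : TilesSubPatterns M P) (hLB : ContainsLB P)
    (y b on : Bool) :
    (∃ u ∈ colorClass M (.upArrow y), u.south = π y ∧ u.east = h b ∧ u.west = τ b on) ∧
    ∃ r ∈ colorClass M (.rightArrow y), r.west = h (xor b (y && on)) ∧ r.east = τ b on ∧
      r.north = κ (borrow (xor b (y && on)) (y && on)) := by
  obtain ⟨n, d, m, e, hn, hF⟩ := exists_LBArrow hLB y b on (c := .bit false) (Or.inl rfl)
  obtain ⟨T, hT⟩ := hP _ hF
  constructor
  · refine ⟨T (5 + n) 2, hT.mem_colorClass LBArrow_upArrow, ?_, ?_, ?_⟩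
    · have := hT.north LBArrow_el LBArrow_upArrow
      obtain ⟨x, hx⟩ := hG.el y _ (hT.mem_colorClass LBArrow_el)
      rw [← this, hx]
    -- The el-tiles pass their horizontal glue, so the final bit is traced back to the Up-Arrow; `k`
    -- is the distance from the final bit.
    · have hend : ∀ k, k ≤ m → (T (6 + n + (m - k)) 2).west = h b := by
        intro k
        induction k with
        | zero =>
          intro _
          rw [Nat.sub_zero, hG.bit _ _ (hT.mem_colorClass LBArrow_end)]
        | succ k ih =>
          intro hk
          have h1 := ih (by omega)
          have hel := LBArrow_ellipsis (y := y) (b := b) (on := on) (d := d) (n := n) (m := m)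
            (k := m - (k + 1)) (c := .bit false) (e := e) (by omega)
          obtain ⟨c', hc'⟩ : ∃ c', LBArrow y n b on (.bit false) d m e
              (6 + n + (m - (k + 1)) + 1) 2 = some c' := by
            rw [show 6 + n + (m - (k + 1)) + 1 = 6 + n + (m - k) by omega]
            rcases Nat.eq_zero_or_pos k with rfl | hk0
            · exact ⟨_, LBArrow_end⟩
            · exact ⟨_, LBArrow_ellipsis (by omega)⟩
          have h2 := hT.east hel hc'
          rw [show 6 + n + (m - (k + 1)) + 1 = 6 + n + (m - k) by omega, h1] at h2
          obtain ⟨x, hx⟩ := hG.el _ _ (hT.mem_colorClass hel)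
          rw [hx] at h2 ⊢
          exact h2
      have h1 := hend m le_rfl
      rw [Nat.sub_self, Nat.add_zero] at h1
      obtain ⟨c', hc'⟩ : ∃ c', LBArrow y n b on (.bit false) d m e (5 + n + 1) 2 = some c' := by
        rw [show 5 + n + 1 = 6 + n + 0 by omega]
        rcases Nat.eq_zero_or_pos m with rfl | hm
        · exact ⟨_, LBArrow_end⟩
        · exact ⟨_, LBArrow_ellipsis hm⟩
      have h2 := hT.east LBArrow_upArrow hc'
      rwa [show 5 + n + 1 = 6 + n by omega, h1] at h2
    · have h1 : (T (5 + (n - 1)) 2).east = (T (5 + (n - 1) + 1) 2).west :=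
        hT.east (LBArrow_green (by omega))
          (by rw [show 5 + (n - 1) + 1 = 5 + n by omega]; exact LBArrow_upArrow)
      rw [show 5 + (n - 1) + 1 = 5 + n by omega,
        hG.green _ _ _ (hT.mem_colorClass (LBArrow_green (by omega)))] at h1
      exact h1.symm
  · have hr : LBArrow y n b on (.bit false) d m e 4 2 = some (.rightArrow y) := by simp [LBArrow]
    have hl : LBArrow y n b on (.bit false) d m e 3 2 = some (.bit (xor b (y && on))) := by
      simp [LBArrow]
    have h3 : LBArrow y n b on (.bit false) d m e 3 3 = some (.bit d) := by simp [LBArrow]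
    have h4 : LBArrow y n b on (.bit false) d m e 4 3 = some .carry := by simp [LBArrow]
    have h5 : LBArrow y n b on (.bit false) d m e 5 3 =
        some (.bit (xor d (borrow (xor b (y && on)) (y && on)))) := by simp [LBArrow]
    refine ⟨T 4 2, hT.mem_colorClass hr, ?_, ?_, ?_⟩
    · rw [← hT.east hl hr, hG.bit _ _ (hT.mem_colorClass hl)]
    · have hg := LBArrow_green (y := y) (b := b) (on := on) (d := d) (n := n) (m := m)
        (k := 0) (c := .bit false) (e := e) (by omega)
      have := hT.east hr hg
      rw [this, hG.green _ _ _ (hT.mem_colorClass hg)]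
    · rw [hT.north hr h4]
      have e3 := hT.east h3 h4
      have e4 := hT.east h4 h5
      rw [hG.bit _ _ (hT.mem_colorClass h3)] at e3
      rw [hG.bit _ _ (hT.mem_colorClass h5)] at e4
      -- The bits on both sides of Carry Blue reveal the bit it subtracts, hence its south glue.
      obtain ⟨x, z, hxz⟩ := hG.carry _ (hT.mem_colorClass h4)
      norm_num at e3 e4
      rw [hxz] at e3 e4 ⊢
      obtain rfl := hG.injective e3
      have := hG.injective e4
      simp only [Bool.bne_right_inj] at this
      rw [this]

/-- Three out of four coincidences. -/
theorem eq_of_forall_ne {α : Type*} {x s : Bool → α} {p q : Bool}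
    (h : ∀ b b', (b, b') ≠ (p, q) → x b = s b') : ∀ b, x b = x false ∧ s b = x false := by
  have h00 := h false false
  have h01 := h false true
  have h10 := h true false
  have h11 := h true true
  -- Three edges of the 4-cycle between the values of `x` and of `s` still connect all four.
  cases p <;> cases q <;> simp at h00 h01 h10 h11 <;> rintro (_ | _) <;> grind

/-- Up to renaming of the glues, the tile types of the arrows are the designed ones. -/
theorem HasGlues.exists_signal {v : G} {h κ π : Bool → G} {τ : Bool → Bool → G}
    (hG : HasGlues M v h κ π τ) (hC : HasDesignedCounts M) (hM : Deterministic M)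
    (hP : TilesSubPatterns M P) (hLB : ContainsLB P) (hGE : ContainsGE P) (y : Bool) :
    ∃ σ : Bool → G,
      (∀ x on, ⟨κ (borrow x (y && on)), σ on, τ (xor x (y && on)) on, h x, .rightArrow y⟩ ∈ M) ∧
      (∀ t ∈ colorClass M (.rightArrow y), ∃ x on,
        t = ⟨κ (borrow x (y && on)), σ on, τ (xor x (y && on)) on, h x, .rightArrow y⟩) ∧
      (∀ b on, ⟨σ on, π y, h b, τ b on, .upArrow y⟩ ∈ M) ∧
      ∀ t ∈ colorClass M (.upArrow y), ∃ b on, t = ⟨σ on, π y, h b, τ b on, .upArrow y⟩ := by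
  choose u hu us ue uw using fun p : Bool × Bool => (hG.exists_arrows hP hLB y p.1 p.2).1
  choose r hr rw' re rn using fun p : Bool × Bool => (hG.exists_arrows hP hLB y p.1 p.2).2
  have uinj : Function.Injective u := by
    intro p p' hpp
    have h1 : τ p.1 p.2 = τ p'.1 p'.2 := by rw [← uw p, ← uw p', hpp]
    have := hG.green_injective hM h1
    exact Prod.ext this.1 this.2
  have rinj : Function.Injective r := by
    intro p p' hpp
    have h1 : τ p.1 p.2 = τ p'.1 p'.2 := by rw [← re p, ← re p', hpp]
    have := hG.green_injective hM h1
    exact Prod.ext this.1 this.2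
  -- The four signals `τ b on` are distinct, so the arrows found exhaust the quota of four; an arrow
  -- is then recognized by its Green neighbor.
  have usurj : ∀ t ∈ colorClass M (.upArrow y), ∃ p, t = u p := fun t ht =>
    exists_eq_of_card_le hu uinj (by simpa using hC.upArrow y) ht
  have rsurj : ∀ t ∈ colorClass M (.rightArrow y), ∃ p, t = r p := fun t ht =>
    exists_eq_of_card_le hr rinj (by simpa using hC.rightArrow y) ht
  have hge : ∀ b b' on, P.Contains (GEArrow y b b' on) → (u (b, on)).north = (r (b', on)).south := by
    intro b b' on hF
    obtain ⟨T, hT⟩ := hP _ hF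
    have h42 : GEArrow y b b' on 4 2 = some (.green b on) := by simp [GEArrow]
    have h52 : GEArrow y b b' on 5 2 = some (.upArrow y) := by simp [GEArrow]
    have h53 : GEArrow y b b' on 5 3 = some (.rightArrow y) := by simp [GEArrow]
    have h63 : GEArrow y b b' on 6 3 = some (.green b' on) := by simp [GEArrow]
    have e1 := hT.east h42 h52
    have e2 := hT.east h53 h63
    have e3 := hT.north h52 h53
    rw [hG.green _ _ _ (hT.mem_colorClass h42)] at e1
    rw [hG.green _ _ _ (hT.mem_colorClass h63)] at e2
    norm_num at e1 e2 e3
    obtain ⟨⟨p, o⟩, hp⟩ := usurj _ (hT.mem_colorClass h52)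
    obtain ⟨⟨p', o'⟩, hp'⟩ := rsurj _ (hT.mem_colorClass h53)
    rw [hp, uw] at e1
    rw [hp', re] at e2
    obtain ⟨rfl, rfl⟩ := hG.green_injective hM e1
    obtain ⟨rfl, rfl⟩ := hG.green_injective hM e2
    rw [← hp, ← hp', e3]
  have hσ : ∀ on b, (u (b, on)).north = (u (false, on)).north ∧
      (r (b, on)).south = (u (false, on)).north := by
    intro on
    obtain ⟨p, q, hpq⟩ : ∃ p q, ∀ b b', (b, b') ≠ (p, q) → P.Contains (GEArrow y b b' on) := by
      cases y
      · exact ⟨true, true, hGE.ge1_6 on⟩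
      · exact hGE.ge7_12 on
    exact eq_of_forall_ne (x := fun b => (u (b, on)).north) (s := fun b => (r (b, on)).south)
      fun b b' hb => hge b b' on (hpq b b' hb)
  have ueq : ∀ b on, u (b, on) = ⟨(u (false, on)).north, π y, h b, τ b on, .upArrow y⟩ := by
    intro b on
    ext1
    · exact (hσ on b).1
    · exact us _
    · exact ue _
    · exact uw _
    · exact (mem_colorClass.1 (hu _)).2
  -- The Right-Arrows `r` are indexed by the outgoing bit, the designed ones by the incoming bit;
  -- adding `y && on` converts either into the other.
  have req : ∀ x on, r (xor x (y && on), on) = ⟨κ (borrow x (y && on)), (u (false, on)).north,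
      τ (xor x (y && on)) on, h x, .rightArrow y⟩ := by
    intro x on
    have hx : xor (xor x (y && on)) (y && on) = x := by simp
    have h1 := rw' (xor x (y && on), on)
    have h2 := rn (xor x (y && on), on)
    simp only [hx] at h1 h2
    ext1
    · exact h2
    · exact (hσ on _).2
    · exact re _
    · exact h1
    · exact (mem_colorClass.1 (hr _)).2
  refine ⟨fun on => (u (false, on)).north, fun x on => ?_, fun t ht => ?_, fun b on => ?_,
    fun t ht => ?_⟩
  · rw [← req]
    exact (mem_colorClass.1 (hr _)).1
  · obtain ⟨⟨b, on⟩, rfl⟩ := rsurj t ht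
    refine ⟨xor b (y && on), on, ?_⟩
    rw [← req]
    congr
    simp
  · rw [← ueq]
    exact (mem_colorClass.1 (hu _)).1
  · obtain ⟨⟨b, on⟩, rfl⟩ := usurj t ht
    exact ⟨b, on, ueq b on⟩

/-- The glues are already identified; what remains is that no two of them coincide, which
determinism forbids because the colors or outputs would clash. -/
theorem HasDesignedCounts.hasDesignedCircuitTiles (hC : HasDesignedCounts M)
    (hM : Deterministic M) (hP : TilesSubPatterns M P) (hLB : ContainsLB P)
    (hGE : ContainsGE P) : HasDesignedCircuitTiles M := by
  obtain ⟨v, h, κ, π, τ, hG⟩ := hC.exists_hasGlues hM hP hLB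
  choose σ hr hr' hu hu' using hG.exists_signal hC hM hP hLB hGE
  let ν : VGlue → G
    | .hash => v
    | .carry b => κ b
    | .pass b => π b
    | .signal b on => σ b on
  let η : HGlue → G
    | .bit b => h b
    | .signal b on => τ b on
  have hmem : ∀ d, Designed d → d.rename ν η ∈ M := by
    rintro d (x | ⟨x, y⟩ | ⟨y, x⟩ | ⟨y, x, on⟩ | ⟨y, x, on⟩)
    · exact hG.bit_mem x
    · exact hG.carry_mem x y
    · exact hG.el_mem y x
    · exact hr y x on
    · exact hu y x on
  -- Every horizontal glue is the west glue of a bit or a Green, all of which have south glue `v`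
  -- and different colors.
  have hη : Function.Injective η := by
    have key : ∀ g g', η g = η g' → ∀ c c', (⟨v, v, η g, η g, c⟩ : TileType G G) ∈ M →
        (⟨v, v, η g', η g', c'⟩ : TileType G G) ∈ M → c = c' := fun g g' he c c' hc hc' =>
      congrArg TileType.color (hM _ hc _ hc' rfl he)
    rintro (x | ⟨b, on⟩) (x' | ⟨b', on'⟩) he
    · simpa using key (.bit x) (.bit x') he _ _ (hG.bit_mem x) (hG.bit_mem x')
    · simpa using key (.bit x) (.signal b' on') he _ _ (hG.bit_mem x)
        (hG.green_mem b' on')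
    · simpa using key (.signal b on) (.bit x') he _ _ (hG.green_mem b on)
        (hG.bit_mem x')
    · simpa using key (.signal b on) (.signal b' on') he _ _ (hG.green_mem b on)
        (hG.green_mem b' on')
  refine ⟨ν, η, ?_, hη, fun t => ⟨?_, ?_⟩⟩
  -- Fed with the west bit 0, each vertical glue enters a designed tile whose color and east glue
  -- recover it. Comparing east glues uses the injectivity of `η`.
  · have hex : ∀ g : VGlue, ∃ d, Designed d ∧ d.south = g ∧ d.west = .bit false ∧
        (d.color, d.east) = match g with
          | .hash => (.bit false, .bit false)
          | .carry y => (.carry, .bit y)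
          | .pass y => (.el y, .bit false)
          | .signal y on => (.rightArrow y, .signal (y && on) on) := by
      rintro (_ | y | y | ⟨y, on⟩)
      · exact ⟨_, .bit false, rfl, rfl, rfl⟩
      · exact ⟨_, .carry false y, rfl, rfl, by simp⟩
      · exact ⟨_, .el y false, rfl, rfl, rfl⟩
      · exact ⟨_, .rightArrow y false on, rfl, rfl, by simp⟩
    intro g g' he
    obtain ⟨d, hd, hs, hw, hc⟩ := hex g
    obtain ⟨d', hd', hs', hw', hc'⟩ := hex g'
    have heq := hM _ (hmem d hd) _ (hmem d' hd') (by simp [TileType.rename, hs, hs', he])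
      (by simp [TileType.rename, hw, hw'])
    have hcol : (d.rename ν η).color = (d'.rename ν η).color := by rw [heq]
    have heast : (d.rename ν η).east = (d'.rename ν η).east := by rw [heq]
    change d.color = d'.color at hcol
    replace heast : d.east = d'.east := hη heast
    rw [hcol, heast, hc'] at hc
    cases g <;> cases g' <;> simp_all
  · rintro ⟨ht, hcol⟩
    obtain ⟨c, hc⟩ : ∃ c, c = t.color := ⟨_, rfl⟩
    rw [← hc] at hcol
    have htc : t ∈ colorClass M c := mem_colorClass.2 ⟨ht, hc.symm⟩
    cases c with
    | bit x => exact ⟨_, .bit x, hG.bit x t htc⟩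
    | carry =>
      obtain ⟨x, y, hxy⟩ := hG.carry t htc
      exact ⟨_, .carry x y, hxy⟩
    | el y =>
      obtain ⟨x, hx⟩ := hG.el y t htc
      exact ⟨_, .el y x, hx⟩
    | rightArrow y =>
      obtain ⟨x, on, hx⟩ := hr' y t htc
      exact ⟨_, .rightArrow y x on, hx⟩
    | upArrow y =>
      obtain ⟨x, on, hx⟩ := hu' y t htc
      exact ⟨_, .upArrow y x on, hx⟩
    | green _ _ => exact hcol.elim
    | purple _ => exact hcol.elim
    | bitCopy _ _ => exact hcol.elim
  · rintro ⟨d, hd, rfl⟩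
    refine ⟨hmem d hd, ?_⟩
    cases hd <;> trivial

end

theorem mainTheorem6 {Glue : Type*} (P : Pattern) (hLB : ContainsLB P) (hGE : ContainsGE P)
    (S : RTAS Glue) (hS : S.UniquelyAssembles P) :
    (S.tiles.card = 46 ∧ HasDesignedCircuitTiles S.tiles) ∨ 46 < S.tiles.card := by
  rcases le_or_gt S.tiles.card 46 with h46 | h46
  · have hP := hS.tilesSubPatterns
    have hC := hasDesignedCounts S.unique hP hLB h46
    exact Or.inl ⟨hC.card, hC.hasDesignedCircuitTiles S.unique hP hLB hGE⟩
  · exact Or.inr h46
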